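/- Let $n\ge 1$ and $[n]=\{1,\dots,n\}$. **Noncommutative crossing partitions.** $\mathrm{NCCP}(n)$ is the set of sequences of blocks $\pi=(\pi_1,\dots,\pi_l)$ such that each $\pi_i$ is a nonempty strictly increasing integer sequence, each $p\in[n]$ appears exactly once in $\pi$, and $\max(\pi_i)>\min(\pi_{i+1})$ for $1\le i\le l-1$. The *labeled binary tree of $\pi$* is the unique binary tree with node labels increasing from the root to the leaves whose in-order reading (left subtree, root, right subtree) is the concatenation $\pi_1\pi_2\cdots\pi_l$. Nodes are named by their labels. **Rotations.** Let $T$ be such a tree and let $b$ be a node that is the left child of a node $p$. The *left set* $LS(b)$ consists of the nodes having $b$ in their left subtree. A node $a\in LS(b)$ is *admissible* for $b$ if $a$ is not a proper ancestor of any node $c$ that has $b$ in its left subtree and some label smaller than $b$ in its right subtree. Let $m_1<m_2<\dots<m_k$ be the maximal sequence of nodes in which $m_1$ is the left child of $b$ and $m_{i+1}$ is the left child of $m_i$. Given an admissible $a$ and a subset $M\subseteq\{m_1,\dots,m_k\}$, form two trees: $T_1$ has root $b$, and the nodes $b$ and those in $M$, in increasing order, are joined by left edges, each keeping its right subtree;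 $T_2$ is obtained from $T$ by replacing the left subtree of $p$ by the nodes of $\{m_1,\dots,m_k\}\setminus M$, in increasing order, joined by left edges, each keeping its right subtree. The *right-extended sequence* of a node is the maximal sequence starting there and following right edges. The rotated tree is obtained from $T_2$ by sorting the union of the right-extended sequences of $a$ in $T_2$ and of $b$ in $T_1$ in increasing order into one sequence, starting at $a$, joined by right edges, each node keeping its left subtree. We write $\pi\lessdot\pi'$, *with label $(a,b)$*, if the tree of $\pi'$ is obtained in this way from the tree of $\pi$ with the nodes $a$ and $b$ (for some $M$). The reflexive transitive closure $\le$ of $\lessdot$ is a partial order on $\mathrm{NCCP}(n)$; write $\mathcal L_{NCCP}(n)=(\mathrm{NCCP}(n),\le)$. **Labeled parking functions.** A parking function of length $m$ is a sequence $(a_1,\dots,a_m)$ of integers in $[m]$ whose increasing rearrangement $\tilde a_1\le\dots\le\tilde a_m$ satisfies $\tilde a_i\le i$ for all $i$. A labeled parking function of length $m$ is a pair $(\mathbf a,\mathbf b)$ of sequences in $[m]$ of length $m$ such that $\mathbf a$ is a parking function, $\mathbf b$ is a permutation of $[m]$, and $a_i\le b_i$ for all $i$. **Theorem.** The number of maximal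 chains in $\mathcal L_{NCCP}(n)$ is $((n-1)!)^2$. Moreover, every maximal chain has the form $\pi_0\lessdot\pi_1\lessdot\dots\lessdot\pi_{n-1}$, each step $\pi_{i-1}\lessdot\pi_i$ has exactly one label, which we write $(a_i,\,b_i+1)$, and sending the chain to $\big((a_1,\dots,a_{n-1}),(b_1,\dots,b_{n-1})\big)$ is a bijection from the set of maximal chains of $\mathcal L_{NCCP}(n)$ onto the set of labeled parking functions of length $n-1$. -/

import Mathlib

open scoped Nat

/-! ### Noncommutative crossing partitions -/

/-- A noncommutative crossing partition of `[n] = {1, …, n}`: an ordered list of blocks. Blocks are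
nonempty strictly increasing sequences, each integer of `[n]` appears exactly once, and
`max B > min C` for consecutive blocks `B, C` (that is, some element of `C` is smaller than some
element of `B`). -/
@[ext]
structure NCCP (n : ℕ) where
  /-- The blocks, from left to right. -/
  blocks : List (List ℕ)
  blocks_ne_nil : ∀ B ∈ blocks, B ≠ []
  blocks_increasing : ∀ B ∈ blocks, B.Pairwise (· < ·)
  perm_range : blocks.flatten.Perm (List.range' 1 n)
  max_gt_min : blocks.IsChain (fun B C => ∃ x ∈ B, ∃ y ∈ C, y < x)

/-- The permutation in one-line notation obtained by concatenating the blocks. -/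
def NCCP.word {n : ℕ} (π : NCCP n) : List ℕ := π.blocks.flatten

/-! ### Labeled binary trees

`BinaryTree ℕ` is the type of binary trees (left and right children are distinguished) whose nodes
carry natural numbers as labels; `nil` is the empty tree. As all labels of the trees below are
distinct, nodes are named by their labels. -/

namespace LabeledTree

open BinaryTree

/-- The word of a tree: left subtree, then root, then right subtree. -/
def inorder : BinaryTree ℕ → List ℕ
  | nil => []
  | node a l r => inorder l ++ a :: inorder r

/-- The labels increase from the root to the leaves. -/
def Increasing : BinaryTree ℕ → Prop
  | nil => True
  | node a l r =>
      (∀ x ∈ inorder l, a < x) ∧ (∀ x ∈ inorder r, a < x) ∧ Increasing l ∧ Increasing r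

/-- `s` is the full subtree of `t` below some node of `t` (or is empty). -/
def IsSubtree (s : BinaryTree ℕ) : BinaryTree ℕ → Prop
  | nil => s = nil
  | node a l r => s = node a l r ∨ IsSubtree s l ∨ IsSubtree s r

/-- `Replace s s' t t'`: the tree `t'` arises from `t` by replacing an occurrence of the full
subtree `s` by `s'`. -/
inductive Replace (s s' : BinaryTree ℕ) : BinaryTree ℕ → BinaryTree ℕ → Prop
  | here : Replace s s' s s'
  | left {a : ℕ} {l l' r : BinaryTree ℕ} (h : Replace s s' l l') :
      Replace s s' (node a l r) (node a l' r)
  | right {a : ℕ} {l r r' : BinaryTree ℕ} (h : Replace s s' r r') :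
      Replace s s' (node a l r) (node a l r')

/-- The left-extended sequence of the root, from the root upwards; each node is recorded with its
right subtree. -/
def leftSeq : BinaryTree ℕ → List (ℕ × BinaryTree ℕ)
  | nil => []
  | node a l r => (a, r) :: leftSeq l

/-- The tree whose left-extended sequence (with right subtrees) is the given list. -/
def ofLeftSeq : List (ℕ × BinaryTree ℕ) → BinaryTree ℕ
  | [] => nil
  | (a, r) :: xs => node a (ofLeftSeq xs) r

/-- The right-extended sequence of the root, from the root upwards; each node is recorded with its
left subtree. -/
def rightSeq : BinaryTree ℕ → List (ℕ × BinaryTree ℕ)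
  | nil => []
  | node a l r => (a, l) :: rightSeq r

/-- The tree whose right-extended sequence (with left subtrees) is the given list. -/
def ofRightSeq : List (ℕ × BinaryTree ℕ) → BinaryTree ℕ
  | [] => nil
  | (a, l) :: xs => node a l (ofRightSeq xs)

/-- Merge two trees along their right-extended sequences: the nodes of both sequences are sorted
by increasing labels and joined by right edges, and each keeps its left subtree. -/
def mergeRight (s t : BinaryTree ℕ) : BinaryTree ℕ :=
  ofRightSeq (List.merge (rightSeq s) (rightSeq t) (fun x y => decide (x.1 ≤ y.1)))

/-- `c` is a node of `t` whose left subtree contains `x` and whose right subtree contains `y`, so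
the path from `y` to the root is to the right of the path from `x` to the root, and `c` is the node
of largest label common to the two paths. -/
def SplitsAt (t : BinaryTree ℕ) (c x y : ℕ) : Prop :=
  ∃ l r, IsSubtree (node c l r) t ∧ x ∈ inorder l ∧ y ∈ inorder r

/-- `a` belongs to the left set of `b`: it is a node on the path from `b` to the root that this
path enters by a left edge, i.e. `b` lies in the left subtree of `a`. -/
def InLeftSet (t : BinaryTree ℕ) (a b : ℕ) : Prop :=
  ∃ l r, IsSubtree (node a l r) t ∧ b ∈ inorder l

/-- `a` is a node on the path from `c` to the root, other than `c`. -/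
def IsProperAncestor (t : BinaryTree ℕ) (a c : ℕ) : Prop :=
  ∃ l r, IsSubtree (node a l r) t ∧ (c ∈ inorder l ∨ c ∈ inorder r)

/-- The nodes `a` that may be chosen for `b` in a rotation: `a` is in the left set of `b`, and is
not a proper ancestor of a node `c` at which a path from a smaller label `y` to the root leaves the
path of `b` to the right. (The leftmost such `y` yields the `c` farthest from the root, so it
excludes all that the other ones exclude.) -/
def Admissible (t : BinaryTree ℕ) (a b : ℕ) : Prop :=
  InLeftSet t a b ∧ ∀ y c, y < b → SplitsAt t c b y → ¬ IsProperAncestor t a c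

/-- `RotatesTo t t' a b`: the tree `t'` is obtained from `t` by a rotation given by the node
`b`, the node `a` and some subset `S` of the further nodes of the left-extended sequence of `b`.
Here `b` is the left child of `p`, with right subtree `u` and left subtree `m`. The nodes of the
left-extended sequence of `m` are divided: those in `S` stay with `b`, giving the tree `t₁` with
root `b`; the others are joined to `p` by left edges, giving the tree `t₂` when this
is put back in place. Finally `t₁` is merged into the right-extended sequence of `a` in `t₂`. -/
def RotatesTo (t t' : BinaryTree ℕ) (a b : ℕ) : Prop :=
  Admissible t a b ∧
  ∃ (p : ℕ) (m u v : BinaryTree ℕ) (S : Finset ℕ) (t₁ t₂ l r : BinaryTree ℕ),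
    S ⊆ ((leftSeq m).map Prod.fst).toFinset ∧
    t₁ = node b (ofLeftSeq ((leftSeq m).filter (fun x => decide (x.1 ∈ S)))) u ∧
    Replace (node p (node b m u) v)
      (node p (ofLeftSeq ((leftSeq m).filter (fun x => decide (x.1 ∉ S)))) v) t t₂ ∧
    Replace (node a l r) (node a l (mergeRight t₁ r)) t₂ t'

end LabeledTree

namespace NCCP

open LabeledTree

variable {n : ℕ}

/-- `t` is the labeled binary tree of `π`: its labels increase from the root, and its word in
in-order is the permutation of `π`. -/
def IsTree (π : NCCP n) (t : BinaryTree ℕ) : Prop :=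
  Increasing t ∧ inorder t = π.word

/-- `π'` is a rotation of `π`, where the edge from `π` to `π'` has the refined label `(a, b)`:
the rotation of the tree of `π` is performed with the nodes labeled `b` and `a`. -/
def CoverLabel (π π' : NCCP n) (a b : ℕ) : Prop :=
  ∃ t t', π.IsTree t ∧ π'.IsTree t' ∧ RotatesTo t t' a b

/-- The cover relation: `π'` is a rotation of `π`. -/
def Cover (π π' : NCCP n) : Prop := ∃ a b, CoverLabel π π' a b

end NCCP

/-! ### The cover relation generates a partial order -/

namespace LabeledTree

open BinaryTree

theorem increasing_unique : ∀ {s t : BinaryTree ℕ}, Increasing s → Increasing t →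
    (inorder s).Nodup → inorder s = inorder t → s = t := by
  intro s
  induction s with
  | nil =>
    intro t _ _ _ h
    cases t with
    | nil => rfl
    | node a l r => simp [inorder] at h
  | node a l r ihl ihr =>
    intro t hs ht hn h
    cases t with
    | nil => simp [inorder] at h
    | node b l' r' =>
      obtain ⟨h1, h2, h3, h4⟩ := hs
      obtain ⟨k1, k2, k3, k4⟩ := ht
      simp only [inorder] at h hn
      have hab : a = b := by
        have ha : a ∈ inorder l' ++ b :: inorder r' := by rw [← h]; simp
        have hb : b ∈ inorder l ++ a :: inorder r := by rw [h]; simp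
        simp only [List.mem_append, List.mem_cons] at ha hb
        rcases ha with ha | ha | ha <;> rcases hb with hb | hb | hb <;> grind
      subst hab
      have hnl : a ∉ inorder l := fun hx => lt_irrefl _ (h1 a hx)
      have hnl' : a ∉ inorder l' := fun hx => lt_irrefl _ (k1 a hx)
      have hll : inorder l = inorder l' ∧ inorder r = inorder r' := by
        rw [List.append_eq_append_iff] at h
        rcases h with ⟨c, hc1, hc2⟩ | ⟨c, hc1, hc2⟩
        · cases c with
          | nil => simp_all
          | cons x c => simp at hc2; simp_all
        · cases c with
          | nil => simp_all
          | cons x c => simp at hc2; simp_all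
      rw [List.nodup_append] at hn
      rw [ihl h3 k3 hn.1 hll.1, ihr h4 k4 (List.nodup_cons.1 hn.2.1).2 hll.2]

/-- `1` for a nonempty tree and `0` for the empty tree. -/
def nonemptyNat : BinaryTree ℕ → ℕ
  | nil => 0
  | node _ _ _ => 1

/-- The number of left edges of a tree. -/
def leftEdges : BinaryTree ℕ → ℕ
  | nil => 0
  | node _ l r => nonemptyNat l + leftEdges l + leftEdges r

theorem leftEdges_node (a : ℕ) (l r : BinaryTree ℕ) :
    leftEdges (node a l r) = nonemptyNat l + leftEdges l + leftEdges r := rfl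

theorem nonemptyNat_node (a : ℕ) (l r : BinaryTree ℕ) : nonemptyNat (node a l r) = 1 := rfl

theorem leftEdges_ofLeftSeq (xs : List (ℕ × BinaryTree ℕ)) :
    nonemptyNat (ofLeftSeq xs) + leftEdges (ofLeftSeq xs) =
      (xs.map fun x => 1 + leftEdges x.2).sum := by
  induction xs with
  | nil => rfl
  | cons x xs ih =>
    simp only [ofLeftSeq, nonemptyNat_node, leftEdges_node, List.map_cons, List.sum_cons]; omega

theorem leftEdges_leftSeq (t : BinaryTree ℕ) :
    nonemptyNat t + leftEdges t = ((leftSeq t).map fun x => 1 + leftEdges x.2).sum := by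
  induction t with
  | nil => rfl
  | node a l r ihl _ =>
    simp only [leftSeq, nonemptyNat_node, leftEdges_node, List.map_cons, List.sum_cons]; omega

theorem leftEdges_ofRightSeq (xs : List (ℕ × BinaryTree ℕ)) :
    leftEdges (ofRightSeq xs) = (xs.map fun x => nonemptyNat x.2 + leftEdges x.2).sum := by
  induction xs with
  | nil => rfl
  | cons x xs ih => simp only [ofRightSeq, leftEdges_node, List.map_cons, List.sum_cons]; omega

theorem leftEdges_rightSeq (t : BinaryTree ℕ) :
    leftEdges t = ((rightSeq t).map fun x => nonemptyNat x.2 + leftEdges x.2).sum := by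
  induction t with
  | nil => rfl
  | node a l r _ ihr =>
    simp only [rightSeq, leftEdges_node, List.map_cons, List.sum_cons]; omega

theorem leftEdges_mergeRight (s t : BinaryTree ℕ) :
    leftEdges (mergeRight s t) = leftEdges s + leftEdges t := by
  rw [mergeRight, leftEdges_ofRightSeq, leftEdges_rightSeq s, leftEdges_rightSeq t,
    ← List.sum_append, ← List.map_append]
  exact ((List.merge_perm_append ..).map _).sum_eq

theorem Replace.leftEdges {s s' t t' : BinaryTree ℕ} (h : Replace s s' t t')
    (hs : nonemptyNat s = nonemptyNat s') :
    nonemptyNat t = nonemptyNat t' ∧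
      leftEdges t + leftEdges s' = leftEdges t' + leftEdges s := by
  induction h with
  | here => exact ⟨hs, by omega⟩
  | left _ ih =>
    obtain ⟨h1, h2⟩ := ih
    refine ⟨rfl, ?_⟩
    rw [leftEdges_node, leftEdges_node]
    omega
  | right _ ih =>
    obtain ⟨h1, h2⟩ := ih
    refine ⟨rfl, ?_⟩
    rw [leftEdges_node, leftEdges_node]
    omega

theorem sum_filter_mem (S : Finset ℕ) (xs : List (ℕ × BinaryTree ℕ)) :
    ((xs.filter (fun x => decide (x.1 ∈ S))).map fun x => 1 + leftEdges x.2).sum +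
      ((xs.filter (fun x => decide (x.1 ∉ S))).map fun x => 1 + leftEdges x.2).sum =
    (xs.map fun x => 1 + leftEdges x.2).sum := by
  induction xs with
  | nil => rfl
  | cons x xs ih =>
    by_cases hx : x.1 ∈ S
    · simp [hx] at ih ⊢; omega
    · simp [hx] at ih ⊢; omega

theorem RotatesTo.leftEdges {t t' : BinaryTree ℕ} {a b : ℕ} (h : RotatesTo t t' a b) :
    LabeledTree.leftEdges t' + 1 = LabeledTree.leftEdges t := by
  obtain ⟨-, p, m, u, v, S, t₁, t₂, l, r, -, rfl, h1, h2⟩ := h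
  have e1 := (h1.leftEdges rfl).2
  have e2 := (h2.leftEdges rfl).2
  have e3 := sum_filter_mem S (leftSeq m)
  rw [← leftEdges_ofLeftSeq, ← leftEdges_ofLeftSeq, ← leftEdges_leftSeq] at e3
  simp only [leftEdges_node, leftEdges_mergeRight, nonemptyNat_node] at e1 e2
  omega

end LabeledTree

namespace NCCP

open LabeledTree

variable {n : ℕ}

theorem IsTree.unique {π : NCCP n} {s t : BinaryTree ℕ} (hs : π.IsTree s) (ht : π.IsTree t) :
    s = t := by
  refine increasing_unique hs.1 ht.1 ?_ (hs.2.trans ht.2.symm)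
  rw [hs.2]
  exact π.perm_range.nodup_iff.2 List.nodup_range'

theorem eq_or_leftEdges_lt {π π' : NCCP n} (h : Relation.ReflTransGen Cover π π') :
    π = π' ∨ ∃ t t', π.IsTree t ∧ π'.IsTree t' ∧ leftEdges t' < leftEdges t := by
  induction h with
  | refl => exact Or.inl rfl
  | tail _ hc ih =>
    obtain ⟨a, b, s, s', hs, hs', hr⟩ := hc
    have := hr.leftEdges
    rcases ih with rfl | ⟨t, t', ht, ht', hlt⟩
    · exact Or.inr ⟨s, s', hs, hs', by omega⟩
    · obtain rfl := ht'.unique hs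
      exact Or.inr ⟨t, s', ht, hs', by omega⟩

/-- The order on noncommutative crossing partitions: `π ≤ π'` if there is a finite (possibly
empty) sequence of rotations from `π` to `π'`. -/
instance : PartialOrder (NCCP n) where
  le := Relation.ReflTransGen Cover
  le_refl _ := Relation.ReflTransGen.refl
  le_trans _ _ _ := Relation.ReflTransGen.trans
  le_antisymm π π' h h' := by
    rcases eq_or_leftEdges_lt h with h | ⟨t, t', ht, ht', hlt⟩
    · exact h
    rcases eq_or_leftEdges_lt h' with h' | ⟨s', s, hs', hs, hlt'⟩
    · exact h'.symm
    obtain rfl := ht.unique hs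
    obtain rfl := ht'.unique hs'
    omega

end NCCP

/-! ### Labeled parking functions -/

/-- `a = (a 0, …, a (m - 1))` is a parking function: a sequence of integers in `[m]` whose
increasing rearrangement `ã₁ ≤ ⋯ ≤ ãₘ` satisfies `ãᵢ ≤ i` (indices start at `0` here). -/
def IsParkingFunction {m : ℕ} (a : Fin m → ℕ) : Prop :=
  (∀ i, a i ∈ Finset.Icc 1 m) ∧ ∀ i : Fin m, (a ∘ Tuple.sort a) i ≤ (i : ℕ) + 1

/-- A labeled parking function: a pair of sequences `a, b` in `[m]` such that `a` is a parking
function, `a i ≤ b i` for all `i`, and each integer of `[m]` appears exactly once in `b`. -/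
@[ext]
structure LabeledParkingFunction (m : ℕ) where
  /-- The parking function. -/
  a : Fin m → ℕ
  /-- The permutation that dominates it. -/
  b : Fin m → ℕ
  isParkingFunction : IsParkingFunction a
  b_mem : ∀ i, b i ∈ Finset.Icc 1 m
  b_perm : ∀ p ∈ Finset.Icc 1 m, ∃! i, b i = p
  a_le_b : ∀ i, a i ≤ b i

/-!
The theorem is proved by working with the increasing binary trees on `{1, …, n}`, which are the
trees of the elements of `NCCP n` (`NCCP.tree_injective`, `NCCP.exists_tree_eq`), and by induction
on `n`, deleting the largest label.

A rotation with label `(a, b)` turns the left child `b` into a right child and keeps all other left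
children (`Rot.lefts`). So along a saturated chain from the tree whose edges are all left edges to
the tree whose edges are all right edges, each of `2, …, n` occurs exactly once as a `b`, and
`a < b`. Conversely a sequence `a` with `1 ≤ a i ≤ b i` for a permutation `b` is a parking function
(`isParkingFunction_of_le`). Hence it suffices to show that each list of labels `(a, b)`, in which
`b` runs through `2, …, n` in some order and `1 ≤ a < b`, is the list of labels of exactly one
saturated chain; there are `((n - 1)!)²` such lists.

The largest label `N` is a leaf. Deleting it turns rotations with `b ≠ N` into rotations with the
same label (`Rot.del`) and makes the rotation with `b = N` trivial (`Rot.del_eq_of_top`). Hence a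
chain on `N` labels projects to a chain on `N - 1` labels. It remains to see that a chain on
`N - 1` labels, a moment in this chain and a number `a < N` come from exactly one chain in which
`N` is moved at this moment, with label `(a, N)`. In a tree with labels below `N`, each `a` is
admissible for exactly one position of a new left leaf `N` (`exists_rot_top`,
`Rot.unique_of_top`); this fixes the chain at the given moment. Before that moment `N` is a left
leaf. Whatever is reached from a node by left edges only after a rotation was so reached before it
(`Rot.spine_left`), so if `N` is the left child of `q` after a rotation, then before it `N` was the
end of the sequence of left edges starting at `q`: the position of `N` is determined backwards
(`Rot.lift_left`, `Rot.eq_of_left`). After that moment `N` is a right leaf. Nodes reached by right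
edges only remain so (`Rot.spine_right`), so the position of `N` is determined forwards
(`Rot.lift_right`, `Rot.eq_of_right`). This gives `exists_path` and `OnPath.unique`.

Finally, every tree other than the least one is the result of a rotation
(`exists_rot_of_ne_bot`, again by deleting `N`), and every tree with a left child admits a rotation.
Since rotations lower the number of left children by one, the maximal chains are exactly the
saturated chains with `n` elements that start at the least one.
-/

namespace LabeledTree

open BinaryTree

theorem ofRightSeq_rightSeq (t : BinaryTree ℕ) : ofRightSeq (rightSeq t) = t := by
  induction t with
  | nil => rfl
  | node a l r _ ih => simp [rightSeq, ofRightSeq, ih]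

@[simp] theorem nil_mergeRight (t : BinaryTree ℕ) : mergeRight nil t = t := by
  simp [mergeRight, rightSeq, ofRightSeq_rightSeq]

@[simp] theorem mergeRight_nil (t : BinaryTree ℕ) : mergeRight t nil = t := by
  simp [mergeRight, rightSeq, ofRightSeq_rightSeq]

theorem mergeRight_node_of_le {a b : ℕ} (h : a ≤ b) (l r l' r' : BinaryTree ℕ) :
    mergeRight (node a l r) (node b l' r') = node a l (mergeRight r (node b l' r')) := by
  simp only [mergeRight, rightSeq]
  rw [List.cons_merge_cons_pos _ _ _ (by simpa using h)]
  rfl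

theorem mergeRight_node_of_lt {a b : ℕ} (h : b < a) (l r l' r' : BinaryTree ℕ) :
    mergeRight (node a l r) (node b l' r') = node b l' (mergeRight (node a l r) r') := by
  simp only [mergeRight, rightSeq]
  rw [List.cons_merge_cons_neg _ _ _ (by simpa using h)]
  rfl

/-- Induction along the comparisons made while two right-extended sequences are merged. -/
theorem mergeRight_induction {P : BinaryTree ℕ → BinaryTree ℕ → BinaryTree ℕ → Prop}
    (nil_left : ∀ t, P nil t t) (nil_right : ∀ s, P s nil s)
    (le : ∀ a l r b l' r', a ≤ b → P r (node b l' r') (mergeRight r (node b l' r')) →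
      P (node a l r) (node b l' r') (node a l (mergeRight r (node b l' r'))))
    (lt : ∀ a l r b l' r', b < a → P (node a l r) r' (mergeRight (node a l r) r') →
      P (node a l r) (node b l' r') (node b l' (mergeRight (node a l r) r')))
    (s t : BinaryTree ℕ) : P s t (mergeRight s t) := by
  induction s generalizing t with
  | nil => simpa using nil_left t
  | node a l r _ ihr =>
    induction t with
    | nil => simpa using nil_right _
    | node b l' r' _ ihr' =>
      rcases le_or_gt a b with h | h
      · rw [mergeRight_node_of_le h]
        exact le _ _ _ _ _ _ h (ihr _)
      · rw [mergeRight_node_of_lt h]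
        exact lt _ _ _ _ _ _ h ihr'

/-! ### A recursive description of rotations -/

/-- `Split m m' m''`: the nodes of the left-extended sequence of `m` are distributed among `m'` and
`m''`, where they are again joined by left edges and keep their right subtrees. -/
inductive Split : BinaryTree ℕ → BinaryTree ℕ → BinaryTree ℕ → Prop
  | nil : Split nil nil nil
  | keep {a : ℕ} {l l' l'' r : BinaryTree ℕ} (h : Split l l' l'') :
      Split (node a l r) (node a l' r) l''
  | take {a : ℕ} {l l' l'' r : BinaryTree ℕ} (h : Split l l' l'') :
      Split (node a l r) l' (node a l'' r)

/-- `Extract b σ l l' s`: the node `b`, with its right subtree and with some of the nodes of the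
left-extended sequence below it, is taken out of `l` and becomes the tree `s`; the rest is `l'`.
The flag `σ` tells whether `l` itself is a left subtree of its surroundings; `b` has to be a left
child. No label smaller than `b` may lie in the right subtree of a node of `l` whose left subtree
contains `b`: this is what admissibility amounts to. -/
inductive Extract (b : ℕ) : Bool → BinaryTree ℕ → BinaryTree ℕ → BinaryTree ℕ → Prop
  | root {m m' m'' u : BinaryTree ℕ} (h : Split m m' m'') :
      Extract b true (node b m u) m' (node b m'' u)
  | left {σ : Bool} {c : ℕ} {l l' r s : BinaryTree ℕ} (h : Extract b true l l' s)
      (hr : ∀ y ∈ inorder r, b ≤ y) : Extract b σ (node c l r) (node c l' r) s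
  | right {σ : Bool} {c : ℕ} {l r r' s : BinaryTree ℕ} (h : Extract b false r r' s) :
      Extract b σ (node c l r) (node c l r') s

/-- A recursive form of `RotatesTo t t' a b`: the tree of `b` is extracted from the left subtree
of `a` and merged into its right subtree. -/
inductive Rot (a b : ℕ) : BinaryTree ℕ → BinaryTree ℕ → Prop
  | here {l l' r s : BinaryTree ℕ} (h : Extract b true l l' s) :
      Rot a b (node a l r) (node a l' (mergeRight s r))
  | left {c : ℕ} {l l' r : BinaryTree ℕ} (h : Rot a b l l') :
      Rot a b (node c l r) (node c l' r)
  | right {c : ℕ} {l r r' : BinaryTree ℕ} (h : Rot a b r r') :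
      Rot a b (node c l r) (node c l r')

/-! ### Labels -/

theorem Split.perm {m m' m'' : BinaryTree ℕ} (h : Split m m' m'') :
    (inorder m).Perm (inorder m' ++ inorder m'') := by
  induction h with
  | nil => rfl
  | keep h ih =>
    rw [List.perm_iff_count] at *
    intro x; have := ih x
    simp only [inorder, List.count_append, List.count_cons] at *; omega
  | take h ih =>
    rw [List.perm_iff_count] at *
    intro x; have := ih x
    simp only [inorder, List.count_append, List.count_cons] at *; omega

theorem perm_mergeRight (s t : BinaryTree ℕ) :
    (inorder (mergeRight s t)).Perm (inorder s ++ inorder t) := by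
  refine mergeRight_induction
    (P := fun s t u => (inorder u).Perm (inorder s ++ inorder t)) ?_ ?_ ?_ ?_ s t
  · simp [inorder]
  · simp [inorder]
  all_goals
    intro a l r b l' r' _ ih
    rw [List.perm_iff_count] at *
    intro x; have := ih x
    simp only [inorder, List.count_append, List.count_cons] at *; omega

theorem Extract.perm {b : ℕ} {σ : Bool} {l l' s : BinaryTree ℕ} (h : Extract b σ l l' s) :
    (inorder l).Perm (inorder l' ++ inorder s) := by
  induction h with
  | root h =>
    have ih := h.perm
    rw [List.perm_iff_count] at *
    intro x; have := ih x
    simp only [inorder, List.count_append, List.count_cons] at *; omega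
  | left h _ ih =>
    rw [List.perm_iff_count] at *
    intro x; have := ih x
    simp only [inorder, List.count_append, List.count_cons] at *; omega
  | right h ih =>
    rw [List.perm_iff_count] at *
    intro x; have := ih x
    simp only [inorder, List.count_append, List.count_cons] at *; omega

theorem Rot.perm {a b : ℕ} {t t' : BinaryTree ℕ} (h : Rot a b t t') :
    (inorder t).Perm (inorder t') := by
  induction h with
  | @here l l' r s h =>
    have ih := h.perm
    have ih' := perm_mergeRight s r
    rw [List.perm_iff_count] at *
    intro x; have := ih x; have := ih' x
    simp only [inorder, List.count_append, List.count_cons] at *; omega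
  | left h ih => exact ih.append_right _
  | right h ih => exact (ih.cons _).append_left _

theorem mem_mergeRight {x : ℕ} {s t : BinaryTree ℕ} :
    x ∈ inorder (mergeRight s t) ↔ x ∈ inorder s ∨ x ∈ inorder t := by
  rw [(perm_mergeRight s t).mem_iff, List.mem_append]

theorem Extract.root_eq {b : ℕ} {σ : Bool} {l l' s : BinaryTree ℕ} (h : Extract b σ l l' s) :
    ∃ m u, s = node b m u := by
  induction h with
  | root h => exact ⟨_, _, rfl⟩
  | left h _ ih => exact ih
  | right h ih => exact ih

theorem Extract.mem {b : ℕ} {σ : Bool} {l l' s : BinaryTree ℕ} (h : Extract b σ l l' s) :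
    b ∈ inorder l := by
  obtain ⟨m, u, rfl⟩ := h.root_eq
  rw [h.perm.mem_iff]
  simp [inorder]

theorem Rot.mem_left {a b : ℕ} {t t' : BinaryTree ℕ} (h : Rot a b t t') : a ∈ inorder t := by
  induction h <;> simp_all [inorder]

theorem Rot.mem_right {a b : ℕ} {t t' : BinaryTree ℕ} (h : Rot a b t t') : b ∈ inorder t := by
  induction h with
  | here h => simp [inorder, h.mem]
  | left h ih => simp [inorder, ih]
  | right h ih => simp [inorder, ih]

theorem Rot.lt {a b : ℕ} {t t' : BinaryTree ℕ} (h : Rot a b t t') (ht : Increasing t) :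
    a < b := by
  induction h with
  | here h => exact ht.1 _ h.mem
  | left h ih => exact ih ht.2.2.1
  | right h ih => exact ih ht.2.2.2

theorem Split.increasing {m m' m'' : BinaryTree ℕ} (h : Split m m' m'') (hm : Increasing m) :
    Increasing m' ∧ Increasing m'' := by
  induction h with
  | nil => exact ⟨trivial, trivial⟩
  | keep h ih =>
    obtain ⟨h1, h2, h3, h4⟩ := hm
    refine ⟨⟨fun x hx => h1 x ?_, h2, (ih h3).1, h4⟩, (ih h3).2⟩
    rw [h.perm.mem_iff]
    exact List.mem_append_left _ hx
  | take h ih =>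
    obtain ⟨h1, h2, h3, h4⟩ := hm
    refine ⟨(ih h3).1, ⟨fun x hx => h1 x ?_, h2, (ih h3).2, h4⟩⟩
    rw [h.perm.mem_iff]
    exact List.mem_append_right _ hx

theorem increasing_mergeRight (s t : BinaryTree ℕ) :
    Increasing s → Increasing t → (∀ x ∈ inorder s, x ∉ inorder t) →
      Increasing (mergeRight s t) := by
  refine mergeRight_induction
    (P := fun s t u => Increasing s → Increasing t → (∀ x ∈ inorder s, x ∉ inorder t) →
      Increasing u) ?_ ?_ ?_ ?_ s t
  · exact fun t _ h _ => h
  · exact fun s h _ _ => h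
  · intro a l r b l' r' hab ih hs ht hd
    have hab' : a < b := lt_of_le_of_ne hab fun h => hd a (by simp [inorder]) (by simp [inorder, h])
    refine ⟨hs.1, fun x hx => ?_, hs.2.2.1, ih hs.2.2.2 ht fun x hx => hd x (by simp [inorder, hx])⟩
    rcases mem_mergeRight.1 hx with hx | hx
    · exact hs.2.1 x hx
    · simp only [inorder, List.mem_append, List.mem_cons] at hx
      rcases hx with hx | rfl | hx
      · exact hab'.trans (ht.1 x hx)
      · exact hab'
      · exact hab'.trans (ht.2.1 x hx)
  · intro a l r b l' r' hab ih hs ht hd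
    refine ⟨ht.1, fun x hx => ?_, ht.2.2.1,
      ih hs ht.2.2.2 fun x hx h => hd x hx (by simp [inorder, h])⟩
    rcases mem_mergeRight.1 hx with hx | hx
    · simp only [inorder, List.mem_append, List.mem_cons] at hx
      rcases hx with hx | rfl | hx
      · exact hab.trans (hs.1 x hx)
      · exact hab
      · exact hab.trans (hs.2.1 x hx)
    · exact ht.2.1 x hx

theorem Extract.increasing {b : ℕ} {σ : Bool} {l l' s : BinaryTree ℕ} (h : Extract b σ l l' s)
    (hl : Increasing l) : Increasing l' ∧ Increasing s := by
  induction h with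
  | root h =>
    obtain ⟨h1, h2, h3, h4⟩ := hl
    refine ⟨(h.increasing h3).1, ⟨fun x hx => h1 x ?_, h2, (h.increasing h3).2, h4⟩⟩
    rw [h.perm.mem_iff]
    exact List.mem_append_right _ hx
  | left h _ ih =>
    obtain ⟨h1, h2, h3, h4⟩ := hl
    refine ⟨⟨fun x hx => h1 x ?_, h2, (ih h3).1, h4⟩, (ih h3).2⟩
    rw [h.perm.mem_iff]
    exact List.mem_append_left _ hx
  | right h ih =>
    obtain ⟨h1, h2, h3, h4⟩ := hl
    refine ⟨⟨h1, fun x hx => h2 x ?_, h3, (ih h4).1⟩, (ih h4).2⟩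
    rw [h.perm.mem_iff]
    exact List.mem_append_left _ hx

theorem nodup_inorder_node {a : ℕ} {l r : BinaryTree ℕ} :
    (inorder (node a l r)).Nodup ↔ (inorder l).Nodup ∧ (inorder r).Nodup ∧ a ∉ inorder l ∧
      a ∉ inorder r ∧ ∀ x ∈ inorder l, x ∉ inorder r := by
  simp only [inorder, List.nodup_append, List.nodup_cons, List.mem_cons]
  grind

theorem Rot.increasing {a b : ℕ} {t t' : BinaryTree ℕ} (h : Rot a b t t') (ht : Increasing t)
    (hn : (inorder t).Nodup) : Increasing t' := by
  induction h with
  | @here l l' r s h =>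
    obtain ⟨h1, h2, h3, h4⟩ := ht
    obtain ⟨n1, n2, n3, n4, n5⟩ := nodup_inorder_node.1 hn
    have hs : ∀ x ∈ inorder s, x ∈ inorder l := fun x hx => by
      rw [h.perm.mem_iff]
      exact List.mem_append_right _ hx
    have hl : ∀ x ∈ inorder l', x ∈ inorder l := fun x hx => by
      rw [h.perm.mem_iff]
      exact List.mem_append_left _ hx
    refine ⟨fun x hx => h1 x (hl x hx), fun x hx => ?_, (h.increasing h3).1,
      increasing_mergeRight s r (h.increasing h3).2 h4 fun x hx => n5 x (hs x hx)⟩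
    rcases mem_mergeRight.1 hx with hx | hx
    · exact h1 x (hs x hx)
    · exact h2 x hx
  | left h ih =>
    obtain ⟨h1, h2, h3, h4⟩ := ht
    exact ⟨fun x hx => h1 x (h.perm.mem_iff.2 hx), h2,
      ih h3 (nodup_inorder_node.1 hn).1, h4⟩
  | right h ih =>
    obtain ⟨h1, h2, h3, h4⟩ := ht
    exact ⟨h1, fun x hx => h2 x (h.perm.mem_iff.2 hx), h3,
      ih h4 (nodup_inorder_node.1 hn).2.1⟩

/-! ### Left children -/

/-- The multiset of the labels of the left children of a tree. The flag tells whether the root of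
the tree counts as a left child, that is, whether the tree is a left subtree of its surroundings. -/
def lefts : Bool → BinaryTree ℕ → Multiset ℕ
  | _, nil => 0
  | σ, node a l r => (if σ then {a} else 0) + lefts true l + lefts false r

theorem Split.lefts {m m' m'' : BinaryTree ℕ} (h : Split m m' m'') :
    lefts true m = lefts true m' + lefts true m'' := by
  induction h with
  | nil => rfl
  | keep h ih => simp only [LabeledTree.lefts, ih]; abel
  | take h ih => simp only [LabeledTree.lefts, ih]; abel

theorem lefts_mergeRight (s t : BinaryTree ℕ) :
    lefts false (mergeRight s t) = lefts false s + lefts false t := by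
  refine mergeRight_induction
    (P := fun s t u => lefts false u = lefts false s + lefts false t) ?_ ?_ ?_ ?_ s t
  · simp [lefts]
  · simp [lefts]
  all_goals
    intro a l r b l' r' _ ih
    simp only [lefts, ih]; abel

theorem Extract.lefts {b : ℕ} {σ : Bool} {l l' s : BinaryTree ℕ} (h : Extract b σ l l' s) :
    lefts σ l = b ::ₘ (lefts σ l' + lefts false s) := by
  rw [← Multiset.singleton_add]
  induction h with
  | root h => simp [LabeledTree.lefts, h.lefts]; abel
  | left h _ ih => simp only [LabeledTree.lefts, ih]; abel
  | right h ih => simp only [LabeledTree.lefts, ih]; abel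

/-- A rotation given by `b` turns the left child `b` into a right child and preserves all other
left children. -/
theorem Rot.lefts {a b : ℕ} {t t' : BinaryTree ℕ} (h : Rot a b t t') (σ : Bool) :
    lefts σ t = b ::ₘ lefts σ t' := by
  rw [← Multiset.singleton_add]
  induction h generalizing σ with
  | here h =>
    simp only [LabeledTree.lefts, lefts_mergeRight, h.lefts, ← Multiset.singleton_add]; abel
  | left h ih => simp only [LabeledTree.lefts, ih]; abel
  | right h ih => simp only [LabeledTree.lefts, ih]; abel

theorem mem_inorder_of_mem_lefts {x : ℕ} {σ : Bool} {t : BinaryTree ℕ} (h : x ∈ lefts σ t) :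
    x ∈ inorder t := by
  induction t generalizing σ with
  | nil => simp [lefts] at h
  | node a l r ihl ihr =>
    simp only [lefts, Multiset.mem_add] at h
    simp only [inorder, List.mem_append, List.mem_cons]
    rcases h with (h | h) | h
    · split at h <;> simp_all
    · exact Or.inl (ihl h)
    · exact Or.inr (Or.inr (ihr h))

/-- The label of a rotation is determined by the two trees. -/
theorem Rot.label_unique {a b a' b' : ℕ} {t t' : BinaryTree ℕ} (h : Rot a b t t')
    (h' : Rot a' b' t t') : a = a' ∧ b = b' := by
  have hb : b = b' := by
    have := (h.lefts true).symm.trans (h'.lefts true)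
    rw [← Multiset.singleton_add, ← Multiset.singleton_add] at this
    simpa using this
  subst hb
  refine ⟨?_, rfl⟩
  have irrefl : ∀ {a : ℕ} {t : BinaryTree ℕ}, ¬ Rot a b t t := fun h => by
    have := congrArg Multiset.card (h.lefts true)
    simp at this
  have size : ∀ {l l' s r : BinaryTree ℕ}, Extract b true l l' s →
      l' ≠ l ∧ mergeRight s r ≠ r := fun {l l' s r} h => by
    obtain ⟨m, u, rfl⟩ := h.root_eq
    have h1 := h.perm.length_eq
    have h2 := (perm_mergeRight (node b m u) r).length_eq
    simp only [inorder, List.length_append, List.length_cons] at h1 h2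
    constructor
    · rintro rfl; omega
    · intro h; rw [h] at h2; omega
  -- If the two rotations took place in different parts of a tree, then a rotation or an extraction
  -- would leave some subtree unchanged.
  generalize ht : t' = t'' at h'
  induction h generalizing t'' with
  | here h =>
    cases h' with
    | here h' => rfl
    | left h' => simp only [node.injEq] at ht; exact absurd ht.2.2 (size h).2
    | right h' => simp only [node.injEq] at ht; exact absurd ht.2.1 (size (r := nil) h).1
  | left h ih =>
    cases h' with
    | here h' => simp only [node.injEq] at ht; exact absurd ht.2.2.symm (size h').2
    | left h' => simp only [node.injEq] at ht; exact ih _ ht.2.1 h'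
    | right h' => simp only [node.injEq] at ht; obtain ⟨-, rfl, -⟩ := ht; exact absurd h irrefl
  | right h ih =>
    cases h' with
    | here h' => simp only [node.injEq] at ht; exact absurd ht.2.1.symm (size (r := nil) h').1
    | left h' => simp only [node.injEq] at ht; obtain ⟨-, -, rfl⟩ := ht; exact absurd h irrefl
    | right h' => simp only [node.injEq] at ht; exact ih _ ht.2.2 h'

/-! ### Deleting the largest label -/

/-- The tree without the subtree below the node `N`. -/
def del (N : ℕ) : BinaryTree ℕ → BinaryTree ℕ
  | nil => nil
  | node a l r => if a = N then nil else node a (del N l) (del N r)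

/-- All labels are at most `N`, and the nodes labeled `N` are leaves. -/
def TopLeaf (N : ℕ) : BinaryTree ℕ → Prop
  | nil => True
  | node a l r => TopLeaf N l ∧ TopLeaf N r ∧ (a < N ∨ a = N ∧ l = nil ∧ r = nil)

theorem del_node_self (N : ℕ) (l r : BinaryTree ℕ) : del N (node N l r) = nil := by simp [del]

theorem del_node_of_ne {N a : ℕ} (h : a ≠ N) (l r : BinaryTree ℕ) :
    del N (node a l r) = node a (del N l) (del N r) := by simp [del, h]

theorem inorder_eq_nil {t : BinaryTree ℕ} : inorder t = [] ↔ t = nil := by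
  cases t <;> simp [inorder]

theorem topLeaf_of_increasing {N : ℕ} {t : BinaryTree ℕ} (h : Increasing t)
    (hN : ∀ x ∈ inorder t, x ≤ N) : TopLeaf N t := by
  induction t with
  | nil => trivial
  | node a l r ihl ihr =>
    obtain ⟨h1, h2, h3, h4⟩ := h
    simp only [inorder, List.mem_append, List.mem_cons] at hN
    refine ⟨ihl h3 fun x hx => hN x (Or.inl hx), ihr h4 fun x hx => hN x (Or.inr (Or.inr hx)), ?_⟩
    rcases (hN a (Or.inr (Or.inl rfl))).lt_or_eq with ha | rfl
    · exact Or.inl ha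
    · refine Or.inr ⟨rfl, ?_, ?_⟩
      · rw [← inorder_eq_nil, List.eq_nil_iff_forall_not_mem]
        exact fun x hx => absurd (h1 x hx) (hN x (Or.inl hx)).not_gt
      · rw [← inorder_eq_nil, List.eq_nil_iff_forall_not_mem]
        exact fun x hx => absurd (h2 x hx) (hN x (Or.inr (Or.inr hx))).not_gt

theorem mem_of_mem_del {N x : ℕ} {t : BinaryTree ℕ} (h : x ∈ inorder (del N t)) :
    x ∈ inorder t := by
  induction t with
  | nil => exact h
  | node a l r ihl ihr =>
    by_cases ha : a = N
    · simp [del, ha, inorder] at h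
    · simp only [del, ha, if_false, inorder, List.mem_append, List.mem_cons] at h ⊢
      tauto

theorem mem_del {N x : ℕ} {t : BinaryTree ℕ} (ht : TopLeaf N t) :
    x ∈ inorder (del N t) ↔ x ∈ inorder t ∧ x ≠ N := by
  induction t with
  | nil => simp [del, inorder]
  | node a l r ihl ihr =>
    obtain ⟨h1, h2, h3⟩ := ht
    rcases h3 with ha | ⟨rfl, rfl, rfl⟩
    · simp only [del, ha.ne, if_false, inorder, List.mem_append, List.mem_cons, ihl h1, ihr h2]
      grind
    · simp [del, inorder]

theorem del_eq_self {N : ℕ} {t : BinaryTree ℕ} (h : N ∉ inorder t) : del N t = t := by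
  induction t with
  | nil => rfl
  | node a l r ihl ihr =>
    simp only [inorder, List.mem_append, List.mem_cons, not_or] at h
    rw [del_node_of_ne (Ne.symm h.2.1), ihl h.1, ihr h.2.2]

theorem increasing_del {N : ℕ} {t : BinaryTree ℕ} (h : Increasing t) : Increasing (del N t) := by
  induction t with
  | nil => trivial
  | node a l r ihl ihr =>
    by_cases ha : a = N
    · simp [del, ha, Increasing]
    · rw [del_node_of_ne ha]
      exact ⟨fun x hx => h.1 x (mem_of_mem_del hx), fun x hx => h.2.1 x (mem_of_mem_del hx),
        ihl h.2.2.1, ihr h.2.2.2⟩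

theorem Split.topLeaf {N : ℕ} {m m' m'' : BinaryTree ℕ} (h : Split m m' m'') (hm : TopLeaf N m) :
    TopLeaf N m' ∧ TopLeaf N m'' := by
  induction h with
  | nil => exact ⟨trivial, trivial⟩
  | keep h ih =>
    obtain ⟨h1, h2, h3⟩ := hm
    refine ⟨⟨(ih h1).1, h2, ?_⟩, (ih h1).2⟩
    rcases h3 with h3 | ⟨rfl, rfl, rfl⟩
    · exact Or.inl h3
    · cases h; exact Or.inr ⟨rfl, rfl, rfl⟩
  | take h ih =>
    obtain ⟨h1, h2, h3⟩ := hm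
    refine ⟨(ih h1).1, (ih h1).2, h2, ?_⟩
    rcases h3 with h3 | ⟨rfl, rfl, rfl⟩
    · exact Or.inl h3
    · cases h; exact Or.inr ⟨rfl, rfl, rfl⟩

theorem Split.del {N : ℕ} {m m' m'' : BinaryTree ℕ} (h : Split m m' m'') (hm : TopLeaf N m) :
    Split (del N m) (del N m') (del N m'') := by
  induction h with
  | nil => exact Split.nil
  | keep h ih =>
    obtain ⟨h1, h2, h3⟩ := hm
    rcases h3 with h3 | ⟨rfl, rfl, rfl⟩
    · rw [del_node_of_ne h3.ne, del_node_of_ne h3.ne]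
      exact (ih h1).keep
    · cases h; simpa [LabeledTree.del] using Split.nil
  | take h ih =>
    obtain ⟨h1, h2, h3⟩ := hm
    rcases h3 with h3 | ⟨rfl, rfl, rfl⟩
    · rw [del_node_of_ne h3.ne, del_node_of_ne h3.ne]
      exact (ih h1).take
    · cases h; simpa [LabeledTree.del] using Split.nil

/-- A leaf with the largest label is at the end of a right-extended sequence, so deleting it commutes
with merging. -/
theorem del_mergeRight {N : ℕ} (s t : BinaryTree ℕ) : TopLeaf N s → TopLeaf N t →
    del N (mergeRight s t) = mergeRight (del N s) (del N t) := by
  refine mergeRight_induction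
    (P := fun s t u => TopLeaf N s → TopLeaf N t → del N u = mergeRight (del N s) (del N t))
    ?_ ?_ ?_ ?_ s t
  · simp [del]
  · simp [del]
  · intro a l r b l' r' hab ih hs ht
    have ih := ih hs.2.1 ht
    rcases hs.2.2 with ha | ⟨rfl, rfl, rfl⟩
    · rcases ht.2.2 with hb | ⟨rfl, rfl, rfl⟩
      · rw [del_node_of_ne ha.ne, ih, del_node_of_ne ha.ne, del_node_of_ne hb.ne,
          mergeRight_node_of_le hab]
      · rw [del_node_of_ne ha.ne, ih, del_node_of_ne ha.ne, del_node_self]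
        simp
    · obtain rfl : b = a := by rcases ht.2.2 with h | h <;> omega
      simp [del_node_self]
  · intro a l r b l' r' hab ih hs ht
    have ih := ih hs ht.2.1
    have hb : b ≠ N := by rcases hs.2.2 with h | h <;> omega
    rcases hs.2.2 with ha | ⟨rfl, rfl, rfl⟩
    · rw [del_node_of_ne hb, ih, del_node_of_ne ha.ne, del_node_of_ne hb,
        mergeRight_node_of_lt hab]
    · rw [del_node_of_ne hb, ih, del_node_self, del_node_of_ne hb]
      simp

theorem Extract.topLeaf {N b : ℕ} {σ : Bool} {l l' s : BinaryTree ℕ} (h : Extract b σ l l' s)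
    (hl : TopLeaf N l) : TopLeaf N l' ∧ TopLeaf N s := by
  induction h with
  | root h =>
    obtain ⟨h1, h2, h3⟩ := hl
    refine ⟨(h.topLeaf h1).1, (h.topLeaf h1).2, h2, ?_⟩
    rcases h3 with h3 | ⟨rfl, rfl, rfl⟩
    · exact Or.inl h3
    · cases h; exact Or.inr ⟨rfl, rfl, rfl⟩
  | left h _ ih =>
    obtain ⟨h1, h2, h3⟩ := hl
    rcases h3 with h3 | ⟨rfl, rfl, rfl⟩
    · exact ⟨⟨(ih h1).1, h2, Or.inl h3⟩, (ih h1).2⟩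
    · cases h
  | right h ih =>
    obtain ⟨h1, h2, h3⟩ := hl
    rcases h3 with h3 | ⟨rfl, rfl, rfl⟩
    · exact ⟨⟨h1, (ih h2).1, Or.inl h3⟩, (ih h2).2⟩
    · cases h

theorem Extract.del {N b : ℕ} {σ : Bool} {l l' s : BinaryTree ℕ} (h : Extract b σ l l' s)
    (hb : b ≠ N) (hl : TopLeaf N l) : Extract b σ (del N l) (del N l') (del N s) := by
  induction h with
  | root h =>
    rw [del_node_of_ne hb, del_node_of_ne hb]
    exact Extract.root (h.del hl.1)
  | left h hr ih =>
    obtain ⟨h1, h2, h3⟩ := hl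
    rcases h3 with h3 | ⟨rfl, rfl, rfl⟩
    · rw [del_node_of_ne h3.ne, del_node_of_ne h3.ne]
      exact (ih h1).left fun y hy => hr y (mem_of_mem_del hy)
    · cases h
  | right h ih =>
    obtain ⟨h1, h2, h3⟩ := hl
    rcases h3 with h3 | ⟨rfl, rfl, rfl⟩
    · rw [del_node_of_ne h3.ne, del_node_of_ne h3.ne]
      exact (ih h2).right
    · cases h

/-- Deleting the largest label turns the rotations given by the other labels into rotations. -/
theorem Rot.del {N a b : ℕ} {t t' : BinaryTree ℕ} (h : Rot a b t t')
    (hb : b ≠ N) (ht : TopLeaf N t) : Rot a b (del N t) (del N t') := by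
  induction h with
  | here h =>
    obtain ⟨h1, h2, h3⟩ := ht
    rcases h3 with h3 | ⟨rfl, rfl, rfl⟩
    · rw [del_node_of_ne h3.ne, del_node_of_ne h3.ne, del_mergeRight _ _ (h.topLeaf h1).2 h2]
      exact Rot.here (h.del hb h1)
    · cases h
  | left h ih =>
    obtain ⟨h1, h2, h3⟩ := ht
    rcases h3 with h3 | ⟨rfl, rfl, rfl⟩
    · rw [del_node_of_ne h3.ne, del_node_of_ne h3.ne]
      exact (ih h1).left
    · cases h
  | right h ih =>
    obtain ⟨h1, h2, h3⟩ := ht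
    rcases h3 with h3 | ⟨rfl, rfl, rfl⟩
    · rw [del_node_of_ne h3.ne, del_node_of_ne h3.ne]
      exact (ih h2).right
    · cases h

theorem Extract.of_top {N : ℕ} {σ : Bool} {l l' s : BinaryTree ℕ} (h : Extract N σ l l' s)
    (hl : TopLeaf N l) : s = node N nil nil ∧ LabeledTree.del N l' = LabeledTree.del N l := by
  induction h with
  | root h =>
    obtain ⟨h1, h2, h3⟩ := hl
    rcases h3 with h3 | ⟨-, rfl, rfl⟩
    · omega
    · cases h; simp [LabeledTree.del]
  | left h hr ih =>
    exact ⟨(ih hl.1).1, by simp only [LabeledTree.del, (ih hl.1).2]⟩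
  | right h ih =>
    exact ⟨(ih hl.2.1).1, by simp only [LabeledTree.del, (ih hl.2.1).2]⟩

/-- Deleting the largest label makes the rotation given by that label trivial. -/
theorem Rot.del_eq_of_top {N a : ℕ} {t t' : BinaryTree ℕ} (h : Rot a N t t')
    (ht : TopLeaf N t) : LabeledTree.del N t = LabeledTree.del N t' := by
  induction h with
  | here h =>
    obtain ⟨h1, h2, h3⟩ := ht
    obtain ⟨rfl, e⟩ := h.of_top h1
    simp only [LabeledTree.del, e, del_mergeRight _ _ (h.topLeaf h1).2 h2]
    simp
  | left h ih => simp only [LabeledTree.del, ih ht.1]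
  | right h ih => simp only [LabeledTree.del, ih ht.2.1]

/-! ### Attaching a new leaf -/

/-- `AddLeaf N τ σ s t`: the tree `t` arises from `s` by attaching a new leaf `N`, as a left child
if `τ` is `true` and as a right child if `τ` is `false`. The flag `σ` tells whether `s` itself is a
left subtree of its surroundings. -/
inductive AddLeaf (N : ℕ) (τ : Bool) : Bool → BinaryTree ℕ → BinaryTree ℕ → Prop
  | leaf : AddLeaf N τ τ nil (node N nil nil)
  | left {σ : Bool} {a : ℕ} {l l' r : BinaryTree ℕ} (h : AddLeaf N τ true l l') :
      AddLeaf N τ σ (node a l r) (node a l' r)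
  | right {σ : Bool} {a : ℕ} {l r r' : BinaryTree ℕ} (h : AddLeaf N τ false r r') :
      AddLeaf N τ σ (node a l r) (node a l r')

theorem AddLeaf.perm {N : ℕ} {τ σ : Bool} {s t : BinaryTree ℕ} (h : AddLeaf N τ σ s t) :
    (inorder t).Perm (N :: inorder s) := by
  induction h with
  | leaf => simp [inorder]
  | left h ih => exact ih.append_right _
  | right h ih =>
    rw [List.perm_iff_count] at *
    intro x; have := ih x
    simp only [inorder, List.count_append, List.count_cons] at *; omega

theorem AddLeaf.del {N : ℕ} {τ σ : Bool} {s t : BinaryTree ℕ} (h : AddLeaf N τ σ s t)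
    (hN : N ∉ inorder s) : LabeledTree.del N t = s := by
  induction h with
  | leaf => simp [LabeledTree.del]
  | left h ih =>
    simp only [inorder, List.mem_append, List.mem_cons, not_or] at hN
    rw [del_node_of_ne (Ne.symm hN.2.1), ih hN.1, del_eq_self hN.2.2]
  | right h ih =>
    simp only [inorder, List.mem_append, List.mem_cons, not_or] at hN
    rw [del_node_of_ne (Ne.symm hN.2.1), ih hN.2.2, del_eq_self hN.1]

theorem AddLeaf.lefts {N : ℕ} {τ σ : Bool} {s t : BinaryTree ℕ} (h : AddLeaf N τ σ s t) :
    lefts σ t = lefts σ s + if τ then {N} else 0 := by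
  induction h with
  | leaf => simp [LabeledTree.lefts]
  | left h ih => simp only [LabeledTree.lefts, ih]; abel
  | right h ih => simp only [LabeledTree.lefts, ih]; abel

theorem exists_addLeaf_del {N : ℕ} {t : BinaryTree ℕ} (ht : TopLeaf N t)
    (hn : (inorder t).Nodup) (hN : N ∈ inorder t) (σ : Bool) :
    ∃ τ, AddLeaf N τ σ (del N t) t := by
  induction t generalizing σ with
  | nil => simp [inorder] at hN
  | node a l r ihl ihr =>
    obtain ⟨h1, h2, h3⟩ := ht
    obtain ⟨n1, n2, n3, n4, n5⟩ := nodup_inorder_node.1 hn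
    rcases h3 with h3 | ⟨rfl, rfl, rfl⟩
    · rw [del_node_of_ne h3.ne]
      simp only [inorder, List.mem_append, List.mem_cons, h3.ne', false_or] at hN
      rcases hN with hN | hN
      · obtain ⟨τ, h⟩ := ihl h1 n1 hN true
        rw [del_eq_self (n5 N hN)]
        exact ⟨τ, h.left⟩
      · obtain ⟨τ, h⟩ := ihr h2 n2 hN false
        rw [del_eq_self fun h => n5 N h hN]
        exact ⟨τ, h.right⟩
    · rw [del_node_self]
      exact ⟨σ, .leaf⟩

theorem addLeaf_del_iff {N : ℕ} {t : BinaryTree ℕ} (ht : TopLeaf N t)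
    (hn : (inorder t).Nodup) (hN : N ∈ inorder t) (σ τ : Bool) :
    AddLeaf N τ σ (del N t) t ↔ (N ∈ lefts σ t ↔ τ = true) := by
  have key : ∀ τ, AddLeaf N τ σ (del N t) t → (N ∈ lefts σ t ↔ τ = true) := by
    intro τ h
    have hd : N ∉ lefts σ (del N t) := fun h => ((mem_del ht).1 (mem_inorder_of_mem_lefts h)).2 rfl
    rw [h.lefts]
    cases τ <;> simp [hd]
  refine ⟨key τ, fun h => ?_⟩
  obtain ⟨τ', h'⟩ := exists_addLeaf_del ht hn hN σ
  have := key τ' h'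
  have : τ = τ' := by rw [Bool.eq_iff_iff, ← h, this]
  exact this ▸ h'

/-! ### Lifting rotations to trees with one more leaf -/

theorem Split.lift_fst {N : ℕ} {m m' m'' k' : BinaryTree ℕ} (h : Split m m' m'')
    (hk : AddLeaf N true true m' k') : ∃ k, AddLeaf N true true m k ∧ Split k k' m'' := by
  induction h generalizing k' with
  | nil => cases hk; exact ⟨_, .leaf, Split.nil.keep⟩
  | keep h ih =>
    cases hk with
    | left hk => obtain ⟨k, h1, h2⟩ := ih hk; exact ⟨_, h1.left, h2.keep⟩
    | right hk => exact ⟨_, hk.right, h.keep⟩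
  | take h ih => obtain ⟨k, h1, h2⟩ := ih hk; exact ⟨_, h1.left, h2.take⟩

theorem Split.lift_snd {N : ℕ} {m m' m'' k'' : BinaryTree ℕ} (h : Split m m' m'')
    (hk : AddLeaf N true true m'' k'') : ∃ k, AddLeaf N true true m k ∧ Split k m' k'' := by
  induction h generalizing k'' with
  | nil => cases hk; exact ⟨_, .leaf, Split.nil.take⟩
  | keep h ih => obtain ⟨k, h1, h2⟩ := ih hk; exact ⟨_, h1.left, h2.keep⟩
  | take h ih =>
    cases hk with
    | left hk => obtain ⟨k, h1, h2⟩ := ih hk; exact ⟨_, h1.left, h2.take⟩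
    | right hk => exact ⟨_, hk.right, h.take⟩

theorem addLeaf_left_mergeRight {N : ℕ} (s t : BinaryTree ℕ) :
    ∀ k, AddLeaf N true false (mergeRight s t) k →
      (∃ s', AddLeaf N true false s s' ∧ k = mergeRight s' t) ∨
      ∃ t', AddLeaf N true false t t' ∧ k = mergeRight s t' := by
  refine mergeRight_induction (P := fun s t u => ∀ k, AddLeaf N true false u k →
      (∃ s', AddLeaf N true false s s' ∧ k = mergeRight s' t) ∨
      ∃ t', AddLeaf N true false t t' ∧ k = mergeRight s t') ?_ ?_ ?_ ?_ s t
  · exact fun t k hk => Or.inr ⟨k, hk, by simp⟩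
  · exact fun t k hk => Or.inl ⟨k, hk, by simp⟩
  · intro a l r b l' r' hab ih k hk
    cases hk with
    | left hk => exact Or.inl ⟨_, hk.left, by rw [mergeRight_node_of_le hab]⟩
    | right hk =>
      rcases ih _ hk with ⟨s', hs, rfl⟩ | ⟨t', ht, rfl⟩
      · exact Or.inl ⟨_, hs.right, by rw [mergeRight_node_of_le hab]⟩
      · refine Or.inr ⟨_, ht, ?_⟩
        cases ht <;> rw [mergeRight_node_of_le hab]
  · intro a l r b l' r' hab ih k hk
    cases hk with
    | left hk => exact Or.inr ⟨_, hk.left, by rw [mergeRight_node_of_lt hab]⟩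
    | right hk =>
      rcases ih _ hk with ⟨s', hs, rfl⟩ | ⟨t', ht, rfl⟩
      · refine Or.inl ⟨_, hs, ?_⟩
        cases hs <;> rw [mergeRight_node_of_lt hab]
      · exact Or.inr ⟨_, ht.right, by rw [mergeRight_node_of_lt hab]⟩

theorem le_of_mem_addLeaf {N b : ℕ} {τ σ : Bool} {s t : BinaryTree ℕ} (h : AddLeaf N τ σ s t)
    (hb : b ≤ N) (hs : ∀ y ∈ inorder s, b ≤ y) : ∀ y ∈ inorder t, b ≤ y := by
  intro y hy
  rw [h.perm.mem_iff, List.mem_cons] at hy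
  rcases hy with rfl | hy
  · exact hb
  · exact hs y hy

theorem Extract.lift_left {N b : ℕ} {σ : Bool} {l l' s : BinaryTree ℕ} (h : Extract b σ l l' s)
    (hb : b ≤ N) :
    (∀ k', AddLeaf N true σ l' k' → ∃ k, AddLeaf N true σ l k ∧ Extract b σ k k' s) ∧
    ∀ s', AddLeaf N true false s s' → ∃ k, AddLeaf N true σ l k ∧ Extract b σ k l' s' := by
  induction h with
  | root h =>
    refine ⟨fun k' hk => ?_, fun s' hs => ?_⟩
    · obtain ⟨k, h1, h2⟩ := h.lift_fst hk
      exact ⟨_, h1.left, .root h2⟩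
    · cases hs with
      | left hs =>
        obtain ⟨k, h1, h2⟩ := h.lift_snd hs
        exact ⟨_, h1.left, .root h2⟩
      | right hs => exact ⟨_, hs.right, .root h⟩
  | left h hr ih =>
    refine ⟨fun k' hk => ?_, fun s' hs => ?_⟩
    · cases hk with
      | left hk =>
        obtain ⟨k, h1, h2⟩ := ih.1 _ hk
        exact ⟨_, h1.left, h2.left hr⟩
      | right hk => exact ⟨_, hk.right, h.left (le_of_mem_addLeaf hk hb hr)⟩
    · obtain ⟨k, h1, h2⟩ := ih.2 _ hs
      exact ⟨_, h1.left, h2.left hr⟩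
  | right h ih =>
    refine ⟨fun k' hk => ?_, fun s' hs => ?_⟩
    · cases hk with
      | left hk => exact ⟨_, hk.left, h.right⟩
      | right hk =>
        obtain ⟨k, h1, h2⟩ := ih.1 _ hk
        exact ⟨_, h1.right, h2.right⟩
    · obtain ⟨k, h1, h2⟩ := ih.2 _ hs
      exact ⟨_, h1.right, h2.right⟩

/-- If a left leaf is attached to the result of a rotation, then the rotation can be lifted to one
which leads to the new tree. -/
theorem Rot.lift_left {N a b : ℕ} {σ : Bool} {s s' t' : BinaryTree ℕ} (h : Rot a b s s')
    (hb : b ≤ N) (ht : AddLeaf N true σ s' t') : ∃ t, AddLeaf N true σ s t ∧ Rot a b t t' := by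
  induction h generalizing t' σ with
  | here h =>
    cases ht with
    | left ht =>
      obtain ⟨k, h1, h2⟩ := (h.lift_left hb).1 _ ht
      exact ⟨_, h1.left, .here h2⟩
    | right ht =>
      rcases addLeaf_left_mergeRight _ _ _ ht with ⟨s', hs, rfl⟩ | ⟨r', hr, rfl⟩
      · obtain ⟨k, h1, h2⟩ := (h.lift_left hb).2 _ hs
        exact ⟨_, h1.left, .here h2⟩
      · exact ⟨_, hr.right, .here h⟩
  | left h ih =>
    cases ht with
    | left ht => obtain ⟨t, h1, h2⟩ := ih ht; exact ⟨_, h1.left, h2.left⟩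
    | right ht => exact ⟨_, ht.right, h.left⟩
  | right h ih =>
    cases ht with
    | left ht => exact ⟨_, ht.left, h.right⟩
    | right ht => obtain ⟨t, h1, h2⟩ := ih ht; exact ⟨_, h1.right, h2.right⟩

theorem Split.lift {N : ℕ} {m m' m'' k : BinaryTree ℕ} (h : Split m m' m'')
    (hk : AddLeaf N false true m k) :
    (∃ k', AddLeaf N false true m' k' ∧ Split k k' m'') ∨
    ∃ k'', AddLeaf N false true m'' k'' ∧ Split k m' k'' := by
  induction h generalizing k with
  | nil => cases hk
  | keep h ih =>
    cases hk with
    | left hk =>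
      rcases ih hk with ⟨k', h1, h2⟩ | ⟨k', h1, h2⟩
      · exact Or.inl ⟨_, h1.left, h2.keep⟩
      · exact Or.inr ⟨_, h1, h2.keep⟩
    | right hk => exact Or.inl ⟨_, hk.right, h.keep⟩
  | take h ih =>
    cases hk with
    | left hk =>
      rcases ih hk with ⟨k', h1, h2⟩ | ⟨k', h1, h2⟩
      · exact Or.inl ⟨_, h1, h2.take⟩
      · exact Or.inr ⟨_, h1.left, h2.take⟩
    | right hk => exact Or.inr ⟨_, hk.right, h.take⟩

theorem addLeaf_leaf_mergeRight {N : ℕ} {t : BinaryTree ℕ} (ht : ∀ x ∈ inorder t, x < N) :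
    AddLeaf N false false t (mergeRight (node N nil nil) t) := by
  induction t with
  | nil => simpa using AddLeaf.leaf
  | node a l r _ ih =>
    simp only [inorder, List.mem_append, List.mem_cons] at ht
    rw [mergeRight_node_of_lt (ht a (Or.inr (Or.inl rfl)))]
    exact (ih fun x hx => ht x (Or.inr (Or.inr hx))).right

theorem addLeaf_mergeRight_leaf {N : ℕ} {t : BinaryTree ℕ} (ht : ∀ x ∈ inorder t, x < N) :
    AddLeaf N false false t (mergeRight t (node N nil nil)) := by
  induction t with
  | nil => simpa using AddLeaf.leaf
  | node a l r _ ih =>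
    simp only [inorder, List.mem_append, List.mem_cons] at ht
    rw [mergeRight_node_of_le (ht a (Or.inr (Or.inl rfl))).le]
    exact (ih fun x hx => ht x (Or.inr (Or.inr hx))).right

theorem AddLeaf.mergeRight {N : ℕ} (s t : BinaryTree ℕ) : (∀ x ∈ inorder s, x < N) →
    (∀ x ∈ inorder t, x < N) →
    (∀ s', AddLeaf N false false s s' → AddLeaf N false false (mergeRight s t) (mergeRight s' t)) ∧
    ∀ t', AddLeaf N false false t t' →
      AddLeaf N false false (LabeledTree.mergeRight s t) (LabeledTree.mergeRight s t') := by
  refine mergeRight_induction (P := fun s t u => (∀ x ∈ inorder s, x < N) →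
    (∀ x ∈ inorder t, x < N) →
    (∀ s', AddLeaf N false false s s' → AddLeaf N false false u (LabeledTree.mergeRight s' t)) ∧
    ∀ t', AddLeaf N false false t t' →
      AddLeaf N false false u (LabeledTree.mergeRight s t')) ?_ ?_ ?_ ?_ s t
  · refine fun t _ ht => ⟨fun s' hs => ?_, fun t' ht => by simpa using ht⟩
    cases hs
    exact addLeaf_leaf_mergeRight ht
  · refine fun s hs _ => ⟨fun s' hs => by simpa using hs, fun t' ht => ?_⟩
    cases ht
    exact addLeaf_mergeRight_leaf hs
  · intro a l r b l' r' hab ih hs ht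
    obtain ⟨ih1, ih2⟩ := ih (fun x hx => hs x (by simp [inorder, hx])) ht
    refine ⟨fun s' hs' => ?_, fun t' ht' => ?_⟩
    · cases hs' with
      | left hs' => rw [mergeRight_node_of_le hab]; exact hs'.left
      | right hs' => rw [mergeRight_node_of_le hab]; exact (ih1 _ hs').right
    · have := (ih2 _ ht').right (σ := false) (a := a) (l := l)
      cases ht' <;> rwa [mergeRight_node_of_le hab]
  · intro a l r b l' r' hab ih hs ht
    obtain ⟨ih1, ih2⟩ := ih hs (fun x hx => ht x (by simp [inorder, hx]))
    refine ⟨fun s' hs' => ?_, fun t' ht' => ?_⟩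
    · have := (ih1 _ hs').right (σ := false) (a := b) (l := l')
      cases hs' <;> rwa [mergeRight_node_of_lt hab]
    · cases ht' with
      | left ht' => rw [mergeRight_node_of_lt hab]; exact ht'.left
      | right ht' => rw [mergeRight_node_of_lt hab]; exact (ih2 _ ht').right

theorem Extract.lift_right {N b : ℕ} {σ : Bool} {l l' s k : BinaryTree ℕ} (h : Extract b σ l l' s)
    (hb : b ≤ N) (hk : AddLeaf N false σ l k) :
    (∃ k', AddLeaf N false σ l' k' ∧ Extract b σ k k' s) ∨
    ∃ s', AddLeaf N false false s s' ∧ Extract b σ k l' s' := by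
  induction h generalizing k with
  | root h =>
    cases hk with
    | left hk =>
      rcases h.lift hk with ⟨k', h1, h2⟩ | ⟨k', h1, h2⟩
      · exact Or.inl ⟨_, h1, .root h2⟩
      · exact Or.inr ⟨_, h1.left, .root h2⟩
    | right hk => exact Or.inr ⟨_, hk.right, .root h⟩
  | left h hr ih =>
    cases hk with
    | left hk =>
      rcases ih hk with ⟨k', h1, h2⟩ | ⟨k', h1, h2⟩
      · exact Or.inl ⟨_, h1.left, h2.left hr⟩
      · exact Or.inr ⟨_, h1, h2.left hr⟩
    | right hk => exact Or.inl ⟨_, hk.right, h.left (le_of_mem_addLeaf hk hb hr)⟩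
  | right h ih =>
    cases hk with
    | left hk => exact Or.inl ⟨_, hk.left, h.right⟩
    | right hk =>
      rcases ih hk with ⟨k', h1, h2⟩ | ⟨k', h1, h2⟩
      · exact Or.inl ⟨_, h1.right, h2.right⟩
      · exact Or.inr ⟨_, h1, h2.right⟩

/-- If a right leaf with a larger label is attached to the initial tree of a rotation, then the
rotation can be lifted to one which starts at the new tree. -/
theorem Rot.lift_right {N a b : ℕ} {σ : Bool} {s s' t : BinaryTree ℕ} (h : Rot a b s s')
    (hN : ∀ x ∈ inorder s, x < N) (ht : AddLeaf N false σ s t) :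
    ∃ t', AddLeaf N false σ s' t' ∧ Rot a b t t' := by
  have hb := (hN b h.mem_right).le
  induction h generalizing t σ with
  | here h =>
    simp only [inorder, List.mem_append, List.mem_cons] at hN
    have hm := AddLeaf.mergeRight (N := N) _ _
      (fun x hx => hN x (Or.inl (h.perm.mem_iff.2 (List.mem_append_right _ hx))))
      (fun x hx => hN x (Or.inr (Or.inr hx)))
    cases ht with
    | left ht =>
      rcases h.lift_right hb ht with ⟨k', h1, h2⟩ | ⟨k', h1, h2⟩
      · exact ⟨_, h1.left, .here h2⟩
      · exact ⟨_, (hm.1 _ h1).right, .here h2⟩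
    | right ht => exact ⟨_, (hm.2 _ ht).right, .here h⟩
  | left h ih =>
    simp only [inorder, List.mem_append, List.mem_cons] at hN
    cases ht with
    | left ht =>
      obtain ⟨t, h1, h2⟩ := ih (fun x hx => hN x (Or.inl hx)) ht
      exact ⟨_, h1.left, h2.left⟩
    | right ht => exact ⟨_, ht.right, h.left⟩
  | right h ih =>
    simp only [inorder, List.mem_append, List.mem_cons] at hN
    cases ht with
    | left ht => exact ⟨_, ht.left, h.right⟩
    | right ht =>
      obtain ⟨t, h1, h2⟩ := ih (fun x hx => hN x (Or.inr (Or.inr hx))) ht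
      exact ⟨_, h1.right, h2.right⟩

/-! ### Rotations given by the largest label -/

/-- There is a place in `s` for a new leaf with the largest label at which the leaf can be
extracted: from the root, go to the right child if there is one, and to the left otherwise. -/
theorem exists_extract_leaf (N : ℕ) (s : BinaryTree ℕ) (σ : Bool) (hs : s = nil → σ = true) :
    ∃ k, AddLeaf N true σ s k ∧ Extract N σ k s (node N nil nil) := by
  induction s generalizing σ with
  | nil => obtain rfl := hs rfl; exact ⟨_, .leaf, .root .nil⟩
  | node a l r ihl ihr =>
    by_cases hr : r = nil
    · obtain ⟨k, h1, h2⟩ := ihl true fun _ => rfl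
      exact ⟨_, h1.left, h2.left (by simp [hr, inorder])⟩
    · obtain ⟨k, h1, h2⟩ := ihr false fun h => absurd h hr
      exact ⟨_, h1.right, h2.right⟩

/-- Each node `a` of `s` gives a rotation that moves a new leaf with the largest label. -/
theorem exists_rot_top {N a : ℕ} {s : BinaryTree ℕ} (hN : ∀ x ∈ inorder s, x < N)
    (ha : a ∈ inorder s) (σ : Bool) :
    ∃ t t', AddLeaf N true σ s t ∧ AddLeaf N false σ s t' ∧ Rot a N t t' := by
  induction s generalizing σ with
  | nil => simp [inorder] at ha
  | node c l r ihl ihr =>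
    simp only [inorder, List.mem_append, List.mem_cons] at ha hN
    rcases ha with ha | rfl | ha
    · obtain ⟨t, t', h1, h2, h3⟩ := ihl (fun x hx => hN x (Or.inl hx)) ha true
      exact ⟨_, _, h1.left, h2.left, h3.left⟩
    · obtain ⟨k, h1, h2⟩ := exists_extract_leaf N l true fun _ => rfl
      exact ⟨_, _, h1.left,
        (addLeaf_leaf_mergeRight fun x hx => hN x (Or.inr (Or.inr hx))).right, .here h2⟩
    · obtain ⟨t, t', h1, h2, h3⟩ := ihr (fun x hx => hN x (Or.inr (Or.inr hx))) ha false
      exact ⟨_, _, h1.right, h2.right, h3.right⟩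

/-- A right leaf comes from a rotation. -/
theorem AddLeaf.exists_rot {N : ℕ} {σ : Bool} {s t' : BinaryTree ℕ} (h : AddLeaf N false σ s t')
    (hs : s ≠ nil) : ∃ a t, AddLeaf N true σ s t ∧ Rot a N t t' := by
  induction h with
  | leaf => exact absurd rfl hs
  | left h ih =>
    obtain ⟨a, t, h1, h2⟩ := ih (by rintro rfl; cases h)
    exact ⟨_, _, h1.left, h2.left⟩
  | @right σ a l r r' h ih =>
    by_cases hr : r = nil
    · subst hr
      cases h
      obtain ⟨k, h1, h2⟩ := exists_extract_leaf N l true fun _ => rfl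
      exact ⟨a, _, h1.left, by simpa using Rot.here (r := nil) h2⟩
    · obtain ⟨a, t, h1, h2⟩ := ih hr
      exact ⟨_, _, h1.right, h2.right⟩

theorem Extract.eq_del_of_top {N : ℕ} {σ : Bool} {l l' s : BinaryTree ℕ} (h : Extract N σ l l' s)
    (hl : TopLeaf N l) (hn : (inorder l).Nodup) : l' = LabeledTree.del N l := by
  obtain ⟨rfl, h'⟩ := h.of_top hl
  rw [← h', del_eq_self]
  have := h.perm.nodup_iff.1 hn
  rw [List.nodup_append] at this
  exact fun h => this.2.2 _ h N (by simp [inorder]) rfl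

/-- The place of a leaf with the largest label that can be extracted is unique: below a node with a
right subtree it cannot be on the left, and otherwise it has to be on the left. -/
theorem Extract.unique_of_top {N : ℕ} {σ : Bool} {k₁ k₂ l₁ l₂ s₁ s₂ : BinaryTree ℕ}
    (h₁ : Extract N σ k₁ l₁ s₁) (h₂ : Extract N σ k₂ l₂ s₂) (t₁ : TopLeaf N k₁)
    (t₂ : TopLeaf N k₂) (n₁ : (inorder k₁).Nodup) (n₂ : (inorder k₂).Nodup)
    (hd : LabeledTree.del N k₁ = LabeledTree.del N k₂) : k₁ = k₂ := by
  have ne_nil : ∀ {l l' s : BinaryTree ℕ}, Extract N false l l' s → TopLeaf N l →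
      (inorder l).Nodup → LabeledTree.del N l ≠ nil := fun h t n hl => by
    rw [← h.eq_del_of_top t n] at hl
    subst hl
    cases h
  have right_nil : ∀ {l l' r s : BinaryTree ℕ} {c : ℕ}, Extract N true l l' s →
      (∀ y ∈ inorder r, N ≤ y) → TopLeaf N (node c l r) → (inorder (node c l r)).Nodup →
      r = nil := fun {l l' r s c} h hr t n => by
    have := (nodup_inorder_node.1 n).2.2.2.2 N h.mem
    cases r with
    | nil => rfl
    | node x l r =>
      have h1 := hr x (by simp [inorder])
      have h2 := t.2.1.2.2
      have : x = N := by omega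
      simp_all [inorder]
  have aux : ∀ {c : ℕ} {l r l' s : BinaryTree ℕ} {σ : Bool}, TopLeaf N (node c l r) →
      (Extract N σ l l' s ∨ Extract N σ r l' s) → c ≠ N := fun t h hc => by
    rcases t.2.2 with h' | ⟨-, rfl, rfl⟩
    · omega
    · rcases h with h | h <;> cases h
  induction h₁ generalizing k₂ l₂ s₂ with
  | root h =>
    rw [del_node_self] at hd
    obtain ⟨rfl, rfl⟩ : _ = nil ∧ _ = nil := by simpa using t₁.2.2
    cases h₂ with
    | root h' =>
      obtain ⟨rfl, rfl⟩ : _ = nil ∧ _ = nil := by simpa using t₂.2.2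
      rfl
    | left h' hr => rw [del_node_of_ne (aux t₂ (Or.inl h'))] at hd; cases hd
    | right h' => rw [del_node_of_ne (aux t₂ (Or.inr h'))] at hd; cases hd
  | left h hr ih =>
    have hc := aux t₁ (Or.inl h)
    have hnil := right_nil h hr t₁ n₁
    subst hnil
    cases h₂ with
    | root h' => rw [del_node_of_ne hc, del_node_self] at hd; cases hd
    | left h' hr' =>
      have hnil := right_nil h' hr' t₂ n₂
      subst hnil
      rw [del_node_of_ne hc, del_node_of_ne (aux t₂ (Or.inl h'))] at hd
      simp only [node.injEq] at hd
      rw [hd.1, ih h' t₁.1 t₂.1 (nodup_inorder_node.1 n₁).1 (nodup_inorder_node.1 n₂).1 hd.2.1]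
    | right h' =>
      rw [del_node_of_ne hc, del_node_of_ne (aux t₂ (Or.inr h'))] at hd
      simp only [node.injEq] at hd
      exact absurd hd.2.2.symm (ne_nil h' t₂.2.1 (nodup_inorder_node.1 n₂).2.1)
  | right h ih =>
    have hc := aux t₁ (Or.inr h)
    cases h₂ with
    | root h' => rw [del_node_of_ne hc, del_node_self] at hd; cases hd
    | left h' hr' =>
      have hnil := right_nil h' hr' t₂ n₂
      subst hnil
      rw [del_node_of_ne hc, del_node_of_ne (aux t₂ (Or.inl h'))] at hd
      simp only [node.injEq] at hd
      exact absurd hd.2.2 (ne_nil h t₁.2.1 (nodup_inorder_node.1 n₁).2.1)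
    | right h' =>
      rw [del_node_of_ne hc, del_node_of_ne (aux t₂ (Or.inr h'))] at hd
      simp only [node.injEq] at hd
      have e1 := (nodup_inorder_node.1 n₁).2.2.2.2
      have e2 := (nodup_inorder_node.1 n₂).2.2.2.2
      rw [del_eq_self fun hx => e1 N hx h.mem, del_eq_self fun hx => e2 N hx h'.mem] at hd
      rw [hd.1, hd.2.1,
        ih h' t₁.2.1 t₂.2.1 (nodup_inorder_node.1 n₁).2.1 (nodup_inorder_node.1 n₂).2.1 hd.2.2]

/-- A rotation given by the largest label `N` and by `a` is determined by the tree without `N`. -/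
theorem Rot.unique_of_top {N a : ℕ} {t₁ t₂ t₁' t₂' : BinaryTree ℕ}
    (h₁ : Rot a N t₁ t₁') (h₂ : Rot a N t₂ t₂') (i₁ : TopLeaf N t₁)
    (i₂ : TopLeaf N t₂) (n₁ : (inorder t₁).Nodup) (n₂ : (inorder t₂).Nodup) (ha : a ≠ N)
    (hd : LabeledTree.del N t₁ = LabeledTree.del N t₂) : t₁ = t₂ ∧ t₁' = t₂' := by
  have ne_top : ∀ {c : ℕ} {l r t : BinaryTree ℕ}, TopLeaf N (node c l r) → Rot a N (node c l r) t →
      c ≠ N := fun i h hc => by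
    rcases i.2.2 with h' | ⟨-, rfl, rfl⟩
    · omega
    · rcases h with h | h | h <;> cases h
  induction h₁ generalizing t₂ t₂' with
  | here h =>
    rw [del_node_of_ne ha] at hd
    obtain ⟨n3, n4, n5, n6, n7⟩ := nodup_inorder_node.1 n₁
    cases h₂ with
    | here h' =>
      obtain ⟨n3', n4', n5', n6', n7'⟩ := nodup_inorder_node.1 n₂
      rw [del_node_of_ne ha] at hd
      simp only [node.injEq] at hd
      rw [del_eq_self (n7 N h.mem), del_eq_self (n7' N h'.mem)] at hd
      have e1 := h.unique_of_top h' i₁.1 i₂.1 n3 n3' hd.2.1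
      have e2 := h.eq_del_of_top i₁.1 n3
      have e3 := h'.eq_del_of_top i₂.1 n3'
      rw [(h.of_top i₁.1).1, (h'.of_top i₂.1).1, e2, e3, e1, hd.2.2]
      exact ⟨rfl, rfl⟩
    | left h' =>
      rw [del_node_of_ne (ne_top i₂ h'.left)] at hd
      simp only [node.injEq] at hd
      have := (mem_del i₂.1).2 ⟨h'.mem_left, ha⟩
      rw [← hd.2.1] at this
      exact absurd (mem_of_mem_del this) n5
    | right h' =>
      rw [del_node_of_ne (ne_top i₂ h'.right)] at hd
      simp only [node.injEq] at hd
      have := (mem_del i₂.2.1).2 ⟨h'.mem_left, ha⟩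
      rw [← hd.2.2] at this
      exact absurd (mem_of_mem_del this) n6
  | left h ih =>
    rw [del_node_of_ne (ne_top i₁ h.left)] at hd
    obtain ⟨c₂, l₂, r₂, rfl⟩ : ∃ c l r, t₂ = node c l r := by cases h₂ <;> exact ⟨_, _, _, rfl⟩
    obtain ⟨n3, n4, n5, n6, n7⟩ := nodup_inorder_node.1 n₁
    obtain ⟨n3', n4', n5', n6', n7'⟩ := nodup_inorder_node.1 n₂
    have hal := (mem_del i₁.1).2 ⟨h.mem_left, ha⟩
    rw [del_node_of_ne (ne_top i₂ h₂)] at hd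
    simp only [node.injEq] at hd
    rw [hd.2.1] at hal
    cases h₂ with
    | here h' => exact absurd (mem_of_mem_del hal) n5'
    | left h' =>
      rw [del_eq_self (n7 N h.mem_right), del_eq_self (n7' N h'.mem_right)] at hd
      obtain ⟨rfl, rfl⟩ := ih h' i₁.1 i₂.1 n3 n3' hd.2.1
      rw [hd.1, hd.2.2]
      exact ⟨rfl, rfl⟩
    | right h' => exact absurd h'.mem_left (n7' _ (mem_of_mem_del hal))
  | right h ih =>
    rw [del_node_of_ne (ne_top i₁ h.right)] at hd
    obtain ⟨c₂, l₂, r₂, rfl⟩ : ∃ c l r, t₂ = node c l r := by cases h₂ <;> exact ⟨_, _, _, rfl⟩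
    obtain ⟨n3, n4, n5, n6, n7⟩ := nodup_inorder_node.1 n₁
    obtain ⟨n3', n4', n5', n6', n7'⟩ := nodup_inorder_node.1 n₂
    have hal := (mem_del i₁.2.1).2 ⟨h.mem_left, ha⟩
    rw [del_node_of_ne (ne_top i₂ h₂)] at hd
    simp only [node.injEq] at hd
    rw [hd.2.2] at hal
    cases h₂ with
    | here h' => exact absurd (mem_of_mem_del hal) n6'
    | left h' => exact absurd (mem_of_mem_del hal) (n7' _ h'.mem_left)
    | right h' =>
      rw [del_eq_self fun hx => n7 N hx h.mem_right,
        del_eq_self fun hx => n7' N hx h'.mem_right] at hd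
      obtain ⟨rfl, rfl⟩ := ih h' i₁.2.1 i₂.2.1 n4 n4' hd.2.2
      rw [hd.1, hd.2.1]
      exact ⟨rfl, rfl⟩

/-! ### Rotations and extended sequences -/

/-- `x` lies on the left-extended (`τ = true`) or right-extended (`τ = false`) sequence of the
root. -/
def InSpine (τ : Bool) (x : ℕ) : BinaryTree ℕ → Prop
  | nil => False
  | node a l r => x = a ∨ if τ then InSpine τ x l else InSpine τ x r

/-- `x` is reached from the node `y` by one or more left edges (`τ = true`) or right edges
(`τ = false`). -/
def SpineBelow (τ : Bool) (x y : ℕ) : BinaryTree ℕ → Prop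
  | nil => False
  | node a l r => (y = a ∧ if τ then InSpine τ x l else InSpine τ x r) ∨
      SpineBelow τ x y l ∨ SpineBelow τ x y r

theorem InSpine.mem {τ : Bool} {x : ℕ} {t : BinaryTree ℕ} (h : InSpine τ x t) : x ∈ inorder t := by
  induction t with
  | nil => exact h.elim
  | node a l r ihl ihr => cases τ <;> simp_all [InSpine, inorder] <;> tauto

theorem SpineBelow.mem {τ : Bool} {x y : ℕ} {t : BinaryTree ℕ} (h : SpineBelow τ x y t) :
    x ∈ inorder t ∧ y ∈ inorder t := by
  induction t with
  | nil => exact h.elim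
  | node a l r ihl ihr =>
    simp only [inorder, List.mem_append, List.mem_cons]
    rcases h with ⟨rfl, h⟩ | h | h
    · cases τ
      · exact ⟨Or.inr (Or.inr (InSpine.mem h)), Or.inr (Or.inl rfl)⟩
      · exact ⟨Or.inl (InSpine.mem h), Or.inr (Or.inl rfl)⟩
    · exact ⟨Or.inl (ihl h).1, Or.inl (ihl h).2⟩
    · exact ⟨Or.inr (Or.inr (ihr h).1), Or.inr (Or.inr (ihr h).2)⟩

theorem Split.spine_left {m m' m'' : BinaryTree ℕ} (h : Split m m' m'') (x y : ℕ) :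
    (InSpine true x m' ∨ InSpine true x m'' → InSpine true x m) ∧
    (SpineBelow true x y m' ∨ SpineBelow true x y m'' → SpineBelow true x y m) := by
  induction h <;> simp_all [InSpine, SpineBelow] <;> tauto

theorem spineBelow_left_mergeRight (s t : BinaryTree ℕ) (x y : ℕ) :
    SpineBelow true x y (mergeRight s t) → SpineBelow true x y s ∨ SpineBelow true x y t := by
  refine mergeRight_induction (P := fun s t u => SpineBelow true x y u →
    SpineBelow true x y s ∨ SpineBelow true x y t) ?_ ?_ ?_ ?_ s t
  · exact fun _ => Or.inr
  · exact fun _ => Or.inl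
  all_goals
    intro a l r b l' r' _ ih
    simp only [SpineBelow, if_true] at *
    tauto

theorem Extract.spine_left {b : ℕ} {σ : Bool} {l l' s : BinaryTree ℕ} (h : Extract b σ l l' s)
    (x y : ℕ) : (InSpine true x l' → InSpine true x l) ∧
      (SpineBelow true x y l' ∨ SpineBelow true x y s → SpineBelow true x y l) := by
  induction h with
  | root h => have := h.spine_left x y; simp only [InSpine, SpineBelow, if_true]; tauto
  | left h _ ih => simp only [InSpine, SpineBelow, if_true]; tauto
  | right h ih => simp only [InSpine, SpineBelow, if_true]; tauto

/-- A rotation creates no new relations between nodes joined by left edges. -/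
theorem Rot.spine_left {a b : ℕ} {t t' : BinaryTree ℕ} (h : Rot a b t t') (x y : ℕ) :
    (InSpine true x t' → InSpine true x t) ∧
      (SpineBelow true x y t' → SpineBelow true x y t) := by
  induction h with
  | @here l l' r s h =>
    have := h.spine_left x y
    have := spineBelow_left_mergeRight s r x y
    simp only [InSpine, SpineBelow, if_true]; tauto
  | left h ih => simp only [InSpine, SpineBelow, if_true]; tauto
  | right h ih => simp only [InSpine, SpineBelow, if_true]; tauto

theorem Split.spine_right {m m' m'' : BinaryTree ℕ} (h : Split m m' m'') (x y : ℕ) :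
    SpineBelow false x y m → SpineBelow false x y m' ∨ SpineBelow false x y m'' := by
  induction h <;> simp_all [SpineBelow] <;> tauto

theorem spine_right_mergeRight (s t : BinaryTree ℕ) (x y : ℕ) :
    (InSpine false x s ∨ InSpine false x t → InSpine false x (mergeRight s t)) ∧
    (SpineBelow false x y s ∨ SpineBelow false x y t → SpineBelow false x y (mergeRight s t)) := by
  refine mergeRight_induction (P := fun s t u =>
    (InSpine false x s ∨ InSpine false x t → InSpine false x u) ∧
    (SpineBelow false x y s ∨ SpineBelow false x y t → SpineBelow false x y u)) ?_ ?_ ?_ ?_ s t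
  · simp [InSpine, SpineBelow]
  · simp [InSpine, SpineBelow]
  all_goals
    intro a l r b l' r' _ ih
    simp only [InSpine, SpineBelow, Bool.false_eq_true, if_false] at *
    tauto

theorem Extract.spine_right {b : ℕ} {σ : Bool} {l l' s : BinaryTree ℕ} (h : Extract b σ l l' s)
    (x y : ℕ) : (σ = false → InSpine false x l → InSpine false x l') ∧
      (SpineBelow false x y l → SpineBelow false x y l' ∨ SpineBelow false x y s) := by
  induction h with
  | root h =>
    have := h.spine_right x y
    simp only [SpineBelow, Bool.false_eq_true, if_false]; tauto
  | left h _ ih => simp only [InSpine, SpineBelow, Bool.false_eq_true, if_false]; tauto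
  | right h ih => simp only [InSpine, SpineBelow, Bool.false_eq_true, if_false]; tauto

/-- A rotation preserves all relations between nodes joined by right edges. -/
theorem Rot.spine_right {a b : ℕ} {t t' : BinaryTree ℕ} (h : Rot a b t t') (x y : ℕ) :
    (InSpine false x t → InSpine false x t') ∧
      (SpineBelow false x y t → SpineBelow false x y t') := by
  induction h with
  | @here l l' r s h =>
    have := h.spine_right x y
    have := spine_right_mergeRight s r x y
    simp only [InSpine, SpineBelow, Bool.false_eq_true, if_false]; tauto
  | left h ih => simp only [InSpine, SpineBelow, Bool.false_eq_true, if_false]; tauto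
  | right h ih => simp only [InSpine, SpineBelow, Bool.false_eq_true, if_false]; tauto

theorem AddLeaf.exists_spineBelow {N : ℕ} {τ σ : Bool} {s t : BinaryTree ℕ}
    (h : AddLeaf N τ σ s t) (hs : s ≠ nil) : ∃ q, SpineBelow τ N q t := by
  induction h with
  | leaf => exact absurd rfl hs
  | @left σ a l l' r h ih =>
    by_cases hl : l = nil
    · subst hl; cases h; exact ⟨a, Or.inl ⟨rfl, by simp [InSpine]⟩⟩
    · obtain ⟨q, hq⟩ := ih hl; exact ⟨q, Or.inr (Or.inl hq)⟩
  | @right σ a l r r' h ih =>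
    by_cases hr : r = nil
    · subst hr; cases h; exact ⟨a, Or.inl ⟨rfl, by simp [InSpine]⟩⟩
    · obtain ⟨q, hq⟩ := ih hr; exact ⟨q, Or.inr (Or.inr hq)⟩

theorem AddLeaf.eq_of_inSpine {N : ℕ} {τ : Bool} {s t₁ t₂ : BinaryTree ℕ}
    (h₁ : AddLeaf N τ τ s t₁) (h₂ : AddLeaf N τ τ s t₂) (hN : N ∉ inorder s)
    (k₁ : InSpine τ N t₁) (k₂ : InSpine τ N t₂) : t₁ = t₂ := by
  induction s generalizing t₁ t₂ with
  | nil => cases h₁; cases h₂; rfl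
  | node a l r ihl ihr =>
    simp only [inorder, List.mem_append, List.mem_cons, not_or] at hN
    have side : ∀ {c l r}, c = a → InSpine τ N (node c l r) →
        if τ then InSpine τ N l else InSpine τ N r := by
      rintro c l r rfl h
      exact Or.resolve_left h hN.2.1
    cases h₁ with
    | left h₁ =>
      have k₁ := side rfl k₁
      cases τ
      · exact absurd (InSpine.mem k₁) hN.2.2
      · cases h₂ with
        | left h₂ => rw [ihl h₁ h₂ hN.1 k₁ (side rfl k₂)]
        | right h₂ => exact absurd (InSpine.mem (side rfl k₂)) hN.1
    | right h₁ =>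
      have k₁ := side rfl k₁
      cases τ
      · cases h₂ with
        | left h₂ => exact absurd (InSpine.mem (side rfl k₂)) hN.2.2
        | right h₂ => rw [ihr h₁ h₂ hN.2.2 k₁ (side rfl k₂)]
      · exact absurd (InSpine.mem k₁) hN.1

theorem AddLeaf.mem_iff {N x : ℕ} {τ σ : Bool} {s t : BinaryTree ℕ} (h : AddLeaf N τ σ s t) :
    x ∈ inorder t ↔ x = N ∨ x ∈ inorder s := by
  rw [h.perm.mem_iff, List.mem_cons]

theorem AddLeaf.not_spineBelow_self {N : ℕ} {τ σ : Bool} {s t : BinaryTree ℕ}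
    (h : AddLeaf N τ σ s t) (hN : N ∉ inorder s) : ¬ SpineBelow τ N N t := by
  intro k
  induction h with
  | leaf => cases τ <;> simp [SpineBelow, InSpine] at k
  | left h ih =>
    simp only [inorder, List.mem_append, List.mem_cons, not_or] at hN
    rcases k with ⟨rfl, -⟩ | k | k
    · exact hN.2.1 rfl
    · exact ih hN.1 k
    · exact hN.2.2 k.mem.1
  | right h ih =>
    simp only [inorder, List.mem_append, List.mem_cons, not_or] at hN
    rcases k with ⟨rfl, -⟩ | k | k
    · exact hN.2.1 rfl
    · exact hN.1 k.mem.1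
    · exact ih hN.2.2 k

/-- The place of a new leaf is determined by any node from which it is reached by left edges only
(if it is a left child) or by right edges only (if it is a right child). -/
theorem AddLeaf.eq_of_spineBelow {N q : ℕ} {τ σ : Bool} {s t₁ t₂ : BinaryTree ℕ}
    (h₁ : AddLeaf N τ σ s t₁) (h₂ : AddLeaf N τ σ s t₂) (hN : N ∉ inorder s)
    (hs : (inorder s).Nodup) (k₁ : SpineBelow τ N q t₁) (k₂ : SpineBelow τ N q t₂) :
    t₁ = t₂ := by
  induction s generalizing σ t₁ t₂ with
  | nil => cases h₁; cases h₂; rfl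
  | node a l r ihl ihr =>
    obtain ⟨n1, n2, n3, n4, n5⟩ := nodup_inorder_node.1 hs
    simp only [inorder, List.mem_append, List.mem_cons, not_or] at hN
    -- If the leaf is attached below the left (right) subtree, then `q` is the root or lies there.
    have left : ∀ {l'}, AddLeaf N τ true l l' → SpineBelow τ N q (node a l' r) →
        (q = a ∧ τ = true ∧ InSpine τ N l') ∨ (q ≠ a ∧ q ∈ inorder l ∧ SpineBelow τ N q l') := by
      intro l' h k
      rcases k with ⟨rfl, k⟩ | k | k
      · cases τ
        · exact absurd (InSpine.mem k) hN.2.2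
        · exact Or.inl ⟨rfl, rfl, k⟩
      · by_cases hq : q = N
        · subst hq
          exact absurd k (h.not_spineBelow_self hN.1)
        · have hq' := (h.mem_iff.1 k.mem.2).resolve_left hq
          exact Or.inr ⟨fun e => n3 (e ▸ hq'), hq', k⟩
      · exact absurd k.mem.1 hN.2.2
    have right : ∀ {r'}, AddLeaf N τ false r r' → SpineBelow τ N q (node a l r') →
        (q = a ∧ τ = false ∧ InSpine τ N r') ∨ (q ≠ a ∧ q ∈ inorder r ∧ SpineBelow τ N q r') := by
      intro r' h k
      rcases k with ⟨rfl, k⟩ | k | k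
      · cases τ
        · exact Or.inl ⟨rfl, rfl, k⟩
        · exact absurd (InSpine.mem k) hN.1
      · exact absurd k.mem.1 hN.1
      · by_cases hq : q = N
        · subst hq
          exact absurd k (h.not_spineBelow_self hN.2.2)
        · have hq' := (h.mem_iff.1 k.mem.2).resolve_left hq
          exact Or.inr ⟨fun e => n4 (e ▸ hq'), hq', k⟩
    cases h₁ with
    | left h₁ =>
      cases h₂ with
      | left h₂ =>
        rcases left h₁ k₁ with ⟨e1, e2, e3⟩ | ⟨e1, e2, e3⟩ <;>
        rcases left h₂ k₂ with ⟨f1, f2, f3⟩ | ⟨f1, f2, f3⟩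
        · subst e2; rw [h₁.eq_of_inSpine h₂ hN.1 e3 f3]
        · exact absurd e1 f1
        · exact absurd f1 e1
        · rw [ihl h₁ h₂ hN.1 n1 e3 f3]
      | right h₂ =>
        rcases left h₁ k₁ with ⟨e1, e2, e3⟩ | ⟨e1, e2, e3⟩ <;>
        rcases right h₂ k₂ with ⟨f1, f2, f3⟩ | ⟨f1, f2, f3⟩
        · simp [e2] at f2
        · exact absurd e1 f1
        · exact absurd f1 e1
        · exact absurd f2 (n5 _ e2)
    | right h₁ =>
      cases h₂ with
      | left h₂ =>
        rcases right h₁ k₁ with ⟨e1, e2, e3⟩ | ⟨e1, e2, e3⟩ <;>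
        rcases left h₂ k₂ with ⟨f1, f2, f3⟩ | ⟨f1, f2, f3⟩
        · simp [e2] at f2
        · exact absurd e1 f1
        · exact absurd f1 e1
        · exact absurd e2 (n5 _ f2)
      | right h₂ =>
        rcases right h₁ k₁ with ⟨e1, e2, e3⟩ | ⟨e1, e2, e3⟩ <;>
        rcases right h₂ k₂ with ⟨f1, f2, f3⟩ | ⟨f1, f2, f3⟩
        · subst e2; rw [h₁.eq_of_inSpine h₂ hN.2.2 e3 f3]
        · exact absurd e1 f1
        · exact absurd f1 e1
        · rw [ihr h₁ h₂ hN.2.2 n2 e3 f3]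

/-! ### The trees on `{1, …, n}` -/

/-- `t` is an increasing tree with labels `1, …, n`. -/
def Good (n : ℕ) (t : BinaryTree ℕ) : Prop :=
  Increasing t ∧ (inorder t).Perm (List.range' 1 n)

theorem Good.nodup {n : ℕ} {t : BinaryTree ℕ} (h : Good n t) : (inorder t).Nodup :=
  h.2.nodup_iff.2 List.nodup_range'

theorem Good.mem_iff {n x : ℕ} {t : BinaryTree ℕ} (h : Good n t) :
    x ∈ inorder t ↔ 1 ≤ x ∧ x ≤ n := by
  rw [h.2.mem_iff, List.mem_range'_1]; omega

theorem Good.topLeaf {n : ℕ} {t : BinaryTree ℕ} (h : Good n t) : TopLeaf n t :=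
  topLeaf_of_increasing h.1 fun _ hx => (h.mem_iff.1 hx).2

theorem Good.rot {n a b : ℕ} {t t' : BinaryTree ℕ} (h : Good n t) (hr : Rot a b t t') :
    Good n t' :=
  ⟨hr.increasing h.1 h.nodup, hr.perm.symm.trans h.2⟩

theorem range'_one_succ_perm (n : ℕ) :
    (List.range' 1 (n + 1)).Perm ((n + 1) :: List.range' 1 n) := by
  rw [List.range'_1_concat, add_comm 1 n]
  exact List.perm_append_comm

theorem Good.addLeaf_del_iff {n : ℕ} {t : BinaryTree ℕ} (h : Good (n + 1) t) (τ : Bool) :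
    AddLeaf (n + 1) τ true (del (n + 1) t) t ↔ (n + 1 ∈ lefts true t ↔ τ = true) :=
  LabeledTree.addLeaf_del_iff h.topLeaf h.nodup (h.mem_iff.2 (by omega)) _ _

theorem Good.del {n : ℕ} {t : BinaryTree ℕ} (h : Good (n + 1) t) : Good n (del (n + 1) t) := by
  obtain ⟨τ, hτ⟩ := exists_addLeaf_del h.topLeaf h.nodup (h.mem_iff.2 (by omega)) true
  refine ⟨increasing_del h.1, ?_⟩
  rw [← List.perm_cons (n + 1)]
  exact hτ.perm.symm.trans (h.2.trans (range'_one_succ_perm n))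

theorem AddLeaf.increasing {N : ℕ} {τ σ : Bool} {s t : BinaryTree ℕ} (h : AddLeaf N τ σ s t)
    (hs : Increasing s) (hN : ∀ x ∈ inorder s, x < N) : Increasing t := by
  induction h with
  | leaf => simp [Increasing, inorder]
  | left h ih =>
    obtain ⟨h1, h2, h3, h4⟩ := hs
    simp only [inorder, List.mem_append, List.mem_cons] at hN
    refine ⟨fun x hx => ?_, h2, ih h3 fun x hx => hN x (Or.inl hx), h4⟩
    rcases h.mem_iff.1 hx with rfl | hx
    · exact hN _ (Or.inr (Or.inl rfl))
    · exact h1 x hx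
  | right h ih =>
    obtain ⟨h1, h2, h3, h4⟩ := hs
    simp only [inorder, List.mem_append, List.mem_cons] at hN
    refine ⟨h1, fun x hx => ?_, h3, ih h4 fun x hx => hN x (Or.inr (Or.inr hx))⟩
    rcases h.mem_iff.1 hx with rfl | hx
    · exact hN _ (Or.inr (Or.inl rfl))
    · exact h2 x hx

theorem Good.lt {n x : ℕ} {s : BinaryTree ℕ} (h : Good n s) (hx : x ∈ inorder s) : x < n + 1 :=
  Nat.lt_succ_of_le (h.mem_iff.1 hx).2

theorem Good.addLeaf {n : ℕ} {τ σ : Bool} {s t : BinaryTree ℕ} (h : Good n s)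
    (ht : AddLeaf (n + 1) τ σ s t) : Good (n + 1) t :=
  ⟨ht.increasing h.1 fun _ hx => h.lt hx,
    ht.perm.trans ((h.2.cons _).trans (range'_one_succ_perm n).symm)⟩

theorem Good.del_addLeaf {n : ℕ} {τ σ : Bool} {s t : BinaryTree ℕ} (h : Good n s)
    (ht : AddLeaf (n + 1) τ σ s t) : LabeledTree.del (n + 1) t = s :=
  ht.del fun hx => (h.lt hx).false

theorem Good.ne_nil {n : ℕ} {s : BinaryTree ℕ} (h : Good n s) (hn : 1 ≤ n) : s ≠ nil := by
  rintro rfl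
  have := h.mem_iff.2 ⟨le_rfl, hn⟩
  simp [inorder] at this

/-- The tree with a new node `x` attached at the end of the left-extended sequence of the root. -/
def addBot (x : ℕ) : BinaryTree ℕ → BinaryTree ℕ
  | nil => node x nil nil
  | node a l r => node a (addBot x l) r

/-- The tree with labels `1, …, n` in which all edges are left edges. -/
def bot : ℕ → BinaryTree ℕ
  | 0 => nil
  | n + 1 => addBot (n + 1) (bot n)

theorem addLeaf_addBot (x : ℕ) (t : BinaryTree ℕ) : AddLeaf x true true t (addBot x t) := by
  induction t with
  | nil => exact .leaf
  | node a l r ihl _ => exact ihl.left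

theorem good_bot (n : ℕ) : Good n (bot n) := by
  induction n with
  | zero => exact ⟨trivial, by simp [bot, inorder]⟩
  | succ n ih => exact ih.addLeaf (addLeaf_addBot _ _)

theorem del_bot (n : ℕ) : del (n + 1) (bot (n + 1)) = bot n :=
  (good_bot n).del_addLeaf (addLeaf_addBot _ _)

theorem eq_bot_of_addLeaf {n N : ℕ} {t : BinaryTree ℕ} (h : AddLeaf N true true (bot n) t) :
    t = addBot N (bot n) := by
  have key : ∀ x (s : BinaryTree ℕ), (∀ t, AddLeaf N true true s t → t = addBot N s) →
      ∀ t, AddLeaf N true true (addBot x s) t → t = addBot N (addBot x s) := by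
    intro x s
    induction s with
    | nil =>
      intro _ t ht
      cases ht with
      | left ht => cases ht; rfl
      | right ht => cases ht
    | node a l r ihl _ =>
      intro hs t ht
      cases ht with
      | left ht =>
        rw [ihl (fun t ht => by simpa [addBot] using hs _ ht.left) _ ht]
        rfl
      | right ht =>
        have h1 := hs _ (ht.right (a := a) (l := l))
        simp only [addBot, node.injEq] at h1
        have := (addLeaf_addBot N l).perm.length_eq
        rw [← h1.2.1] at this
        simp at this
  induction n generalizing t with
  | zero => cases h; rfl
  | succ n ih => exact key _ _ (fun t ht => ih ht) _ h

theorem lefts_bot (n : ℕ) : lefts true (bot n) = ((List.range' 1 n : List ℕ) : Multiset ℕ) := by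
  induction n with
  | zero => rfl
  | succ n ih =>
    rw [bot, (addLeaf_addBot _ _).lefts, ih, Multiset.coe_eq_coe.2 (range'_one_succ_perm n),
      ← Multiset.cons_coe, ← Multiset.singleton_add, add_comm]
    rfl

theorem exists_rot_of_lefts_ne {t : BinaryTree ℕ} (h : lefts false t ≠ 0) :
    ∃ a b t', Rot a b t t' := by
  have split : ∀ m : BinaryTree ℕ, Split m m nil := fun m => by
    induction m with
    | nil => exact .nil
    | node a l r ihl _ => exact ihl.keep
  induction t with
  | nil => simp [lefts] at h
  | node a l r _ ihr =>
    cases l with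
    | nil =>
      obtain ⟨x, y, r', hr⟩ := ihr (by simpa [lefts] using h)
      exact ⟨x, y, _, hr.right⟩
    | node b m u => exact ⟨a, b, _, .here (.root (split m))⟩

/-- Every tree other than the one without right edges is the result of a rotation. -/
theorem exists_rot_of_ne_bot {n : ℕ} {t' : BinaryTree ℕ} (h : Good n t') (hb : t' ≠ bot n) :
    ∃ a b t, Good n t ∧ Rot a b t t' := by
  induction n generalizing t' with
  | zero =>
    refine absurd (increasing_unique h.1 (good_bot 0).1 h.nodup ?_) hb
    simpa [bot, inorder] using h.2
  | succ n ih =>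
    have hs := h.del
    by_cases hl : n + 1 ∈ lefts true t'
    · have hadd := (h.addLeaf_del_iff true).2 (by simpa using hl)
      by_cases hsb : del (n + 1) t' = bot n
      · rw [hsb] at hadd
        exact absurd (eq_bot_of_addLeaf hadd) hb
      · obtain ⟨a, b, s, hgs, hr⟩ := ih hs hsb
        obtain ⟨t, ht, hr'⟩ := hr.lift_left (hgs.lt hr.mem_right).le hadd
        exact ⟨a, b, t, hgs.addLeaf ht, hr'⟩
    · have hadd := (h.addLeaf_del_iff false).2 (by simpa using hl)
      obtain ⟨a, t, ht, hr⟩ := hadd.exists_rot (by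
        intro e
        rw [e] at hadd
        cases hadd)
      exact ⟨a, n + 1, t, hs.addLeaf ht, hr⟩

/-! ### Sequences of rotations with prescribed labels -/

/-- `Path L t u`: there is a sequence of rotations from `t` to `u` with the list `L` of labels. -/
def Path : List (ℕ × ℕ) → BinaryTree ℕ → BinaryTree ℕ → Prop
  | [], t, u => t = u
  | p :: L, t, u => ∃ t', Rot p.1 p.2 t t' ∧ Path L t' u

/-- The lists of labels `(a, b)` in which `b` runs through `2, …, n` in some order and
`1 ≤ a < b`. -/
def ValidLabels (n : ℕ) (L : List (ℕ × ℕ)) : Prop :=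
  (L.map Prod.snd).Perm (List.range' 2 (n - 1)) ∧ ∀ p ∈ L, 1 ≤ p.1 ∧ p.1 < p.2

theorem path_append {L₁ L₂ : List (ℕ × ℕ)} {t u : BinaryTree ℕ} :
    Path (L₁ ++ L₂) t u ↔ ∃ s, Path L₁ t s ∧ Path L₂ s u := by
  induction L₁ generalizing t with
  | nil => simp [Path]
  | cons p L ih =>
    simp only [List.cons_append, Path, ih]
    constructor
    · rintro ⟨t', h, s, h1, h2⟩; exact ⟨s, ⟨t', h, h1⟩, h2⟩
    · rintro ⟨s, ⟨t', h, h1⟩, h2⟩; exact ⟨t', h, s, h1, h2⟩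

theorem Path.good {n : ℕ} {L : List (ℕ × ℕ)} {t u : BinaryTree ℕ} (h : Path L t u)
    (ht : Good n t) : Good n u := by
  induction L generalizing t with
  | nil => exact h ▸ ht
  | cons p L ih => obtain ⟨t', h1, h2⟩ := h; exact ih h2 (ht.rot h1)

theorem Path.lefts {L : List (ℕ × ℕ)} {t u : BinaryTree ℕ} (h : Path L t u) (σ : Bool) :
    lefts σ t = (L.map Prod.snd : List ℕ) + lefts σ u := by
  induction L generalizing t with
  | nil => obtain rfl : t = u := h; simp
  | cons p L ih =>
    obtain ⟨t', h1, h2⟩ := h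
    rw [h1.lefts, ih h2, List.map_cons, ← Multiset.cons_coe, Multiset.cons_add]

theorem Path.del {n : ℕ} {L : List (ℕ × ℕ)} {t u : BinaryTree ℕ} (h : Path L t u)
    (ht : Good (n + 1) t) :
    Path (L.filter fun p => decide (p.2 ≠ n + 1)) (del (n + 1) t) (del (n + 1) u) := by
  induction L generalizing t with
  | nil => exact congrArg _ h
  | cons p L ih =>
    obtain ⟨t', h1, h2⟩ := h
    have := ih h2 (ht.rot h1)
    by_cases hp : p.2 = n + 1
    · rw [List.filter_cons_of_neg (by simp [hp])]
      rw [hp] at h1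
      rwa [h1.del_eq_of_top ht.topLeaf]
    · rw [List.filter_cons_of_pos (by simp [hp])]
      exact ⟨_, h1.del hp ht.topLeaf, this⟩

theorem Path.lift_left {n : ℕ} {L : List (ℕ × ℕ)} {s s' t' : BinaryTree ℕ} (h : Path L s s')
    (hs : Good n s) (ht : AddLeaf (n + 1) true true s' t') :
    ∃ t, AddLeaf (n + 1) true true s t ∧ Path L t t' := by
  induction L generalizing s with
  | nil => obtain rfl : s = s' := h; exact ⟨t', ht, rfl⟩
  | cons p L ih =>
    obtain ⟨r, h1, h2⟩ := h
    obtain ⟨t, ht, hp⟩ := ih h2 (hs.rot h1)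
    obtain ⟨t₀, ht₀, hr⟩ := h1.lift_left (hs.lt h1.mem_right).le ht
    exact ⟨t₀, ht₀, t, hr, hp⟩

theorem Path.lift_right {n : ℕ} {L : List (ℕ × ℕ)} {s s' t : BinaryTree ℕ} (h : Path L s s')
    (hs : Good n s) (ht : AddLeaf (n + 1) false true s t) : ∃ t', Path L t t' := by
  induction L generalizing s t with
  | nil => exact ⟨t, rfl⟩
  | cons p L ih =>
    obtain ⟨r, h1, h2⟩ := h
    obtain ⟨t₁, ht₁, hr⟩ := h1.lift_right (fun _ hx => hs.lt hx) ht
    obtain ⟨t', hp⟩ := ih h2 (hs.rot h1) ht₁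
    exact ⟨t', t₁, hr, hp⟩

theorem range'_two_succ_perm {n : ℕ} (hn : 1 ≤ n) :
    (List.range' 2 (n + 1 - 1)).Perm ((n + 1) :: List.range' 2 (n - 1)) := by
  obtain ⟨m, rfl⟩ := Nat.exists_eq_add_of_le' hn
  rw [Nat.add_sub_cancel, Nat.add_sub_cancel, List.range'_1_concat, add_comm 2 m]
  exact List.perm_append_comm

/-- A valid list of labels contains exactly one label given by the largest node; without it, it is
again a valid list. -/
theorem ValidLabels.succ {n : ℕ} {L : List (ℕ × ℕ)} (hn : 1 ≤ n) (h : ValidLabels (n + 1) L) :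
    ∃ A a B, L = A ++ (a, n + 1) :: B ∧ 1 ≤ a ∧ a ≤ n ∧ (∀ p ∈ A ++ B, p.2 ≠ n + 1) ∧
      ValidLabels n (A ++ B) := by
  obtain ⟨h1, h2⟩ := h
  replace h1 := h1.trans (range'_two_succ_perm hn)
  have hm : n + 1 ∈ L.map Prod.snd := h1.mem_iff.2 (by simp)
  obtain ⟨⟨a, b⟩, hp, rfl : b = n + 1⟩ := List.mem_map.1 hm
  obtain ⟨A, B, rfl⟩ := List.append_of_mem hp
  have h3 : ((A ++ B).map Prod.snd).Perm (List.range' 2 (n - 1)) := by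
    rw [← List.perm_cons (n + 1)]
    refine List.Perm.trans ?_ h1
    simp only [List.map_append, List.map_cons]
    exact List.perm_middle.symm
  have h4 := h2 _ hp
  refine ⟨A, a, B, rfl, h4.1, Nat.le_of_lt_succ h4.2, fun p hp hpn => ?_, h3, fun p hp => ?_⟩
  · have := h3.mem_iff.1 (List.mem_map_of_mem (f := Prod.snd) hp)
    rw [List.mem_range'_1] at this
    omega
  · refine h2 p ?_
    simp only [List.mem_append, List.mem_cons] at hp ⊢
    tauto

/-- Every valid list of labels belongs to a sequence of rotations that starts at the tree without
right edges: the sequence for the smaller labels is lifted, backwards from the moment when the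
largest label is moved with the new leaf on the left, and forwards with the leaf on the right. -/
theorem exists_path {n : ℕ} (hn : 1 ≤ n) {L : List (ℕ × ℕ)} (hL : ValidLabels n L) :
    ∃ v, Path L (bot n) v := by
  induction n, hn using Nat.le_induction generalizing L with
  | base =>
    have : L = [] := by simpa using hL.1
    subst this
    exact ⟨_, rfl⟩
  | succ n hn ih =>
    obtain ⟨A, a, B, rfl, ha1, han, -, hAB⟩ := hL.succ hn
    obtain ⟨v, hv⟩ := ih hAB
    obtain ⟨s, hA, hB⟩ := path_append.1 hv
    have hs := hA.good (good_bot n)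
    obtain ⟨t, t', ht, ht', hr⟩ := exists_rot_top (a := a) (fun _ hx => hs.lt hx)
      (hs.mem_iff.2 ⟨ha1, han⟩) true
    obtain ⟨t₀, ht₀, hA'⟩ := hA.lift_left (good_bot n) ht
    obtain ⟨v', hB'⟩ := hB.lift_right hs ht'
    refine ⟨v', path_append.2 ⟨t, ?_, t', hr, hB'⟩⟩
    rwa [eq_bot_of_addLeaf ht₀] at hA'

/-- A tree occurs after the labels `L₁` and before the labels `L₂`. -/
def OnPath (n : ℕ) (L₁ L₂ : List (ℕ × ℕ)) (u : BinaryTree ℕ) : Prop :=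
  Path L₁ (bot n) u ∧ ∃ v, Path L₂ u v

theorem OnPath.good {n : ℕ} {L₁ L₂ : List (ℕ × ℕ)} {u : BinaryTree ℕ} (h : OnPath n L₁ L₂ u) :
    Good n u := h.1.good (good_bot n)

theorem OnPath.del {n : ℕ} {L₁ L₂ : List (ℕ × ℕ)} {u : BinaryTree ℕ}
    (h : OnPath (n + 1) L₁ L₂ u) :
    OnPath n (L₁.filter fun p => decide (p.2 ≠ n + 1)) (L₂.filter fun p => decide (p.2 ≠ n + 1))
      (del (n + 1) u) := by
  obtain ⟨v, hv⟩ := h.2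
  exact ⟨del_bot n ▸ h.1.del (good_bot _), _, hv.del h.good⟩

theorem OnPath.next {n : ℕ} {L₁ L₂ : List (ℕ × ℕ)} {p : ℕ × ℕ} {u : BinaryTree ℕ}
    (h : OnPath n L₁ (p :: L₂) u) : ∃ u', Rot p.1 p.2 u u' ∧ OnPath n (L₁ ++ [p]) L₂ u' := by
  obtain ⟨h1, v, u', h2, h3⟩ := h
  exact ⟨u', h2, path_append.2 ⟨u, h1, u', h2, rfl⟩, v, h3⟩

theorem OnPath.prev {n : ℕ} {L₁ L₂ : List (ℕ × ℕ)} {p : ℕ × ℕ} {u' : BinaryTree ℕ}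
    (h : OnPath n (L₁ ++ [p]) L₂ u') : ∃ u, Rot p.1 p.2 u u' ∧ OnPath n L₁ (p :: L₂) u := by
  obtain ⟨h1, v, h3⟩ := h
  obtain ⟨u, h0, w, h2, rfl : w = u'⟩ := path_append.1 h1
  exact ⟨u, h2, h0, v, w, h2, h3⟩

/-- As long as the largest label is a left child, the position of its leaf before a rotation is
determined by its position after the rotation. -/
theorem Rot.eq_of_left {n a b : ℕ} {t₁ t₂ t' : BinaryTree ℕ} (hn : 1 ≤ n) (h₁ : Rot a b t₁ t')
    (h₂ : Rot a b t₂ t') (g₁ : Good (n + 1) t₁) (g₂ : Good (n + 1) t₂)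
    (hl : n + 1 ∈ LabeledTree.lefts true t')
    (hd : LabeledTree.del (n + 1) t₁ = LabeledTree.del (n + 1) t₂) : t₁ = t₂ := by
  have g' := g₁.rot h₁
  obtain ⟨q, hq⟩ := ((g'.addLeaf_del_iff true).2 (by simpa using hl)).exists_spineBelow
    (g'.del.ne_nil hn)
  have e₁ := (g₁.addLeaf_del_iff true).2 (by rw [h₁.lefts]; simp [hl])
  have e₂ := (g₂.addLeaf_del_iff true).2 (by rw [h₂.lefts]; simp [hl])
  rw [← hd] at e₂
  exact e₁.eq_of_spineBelow e₂ (fun hx => (g₁.del.lt hx).false) g₁.del.nodup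
    ((h₁.spine_left _ _).2 hq) ((h₂.spine_left _ _).2 hq)

/-- As soon as the largest label is not a left child, the position of its leaf after a rotation is
determined by its position before the rotation. -/
theorem Rot.eq_of_right {n a b : ℕ} {t t₁ t₂ : BinaryTree ℕ} (hn : 1 ≤ n) (h₁ : Rot a b t t₁)
    (h₂ : Rot a b t t₂) (g : Good (n + 1) t)
    (hl : n + 1 ∉ LabeledTree.lefts true t)
    (hd : LabeledTree.del (n + 1) t₁ = LabeledTree.del (n + 1) t₂) : t₁ = t₂ := by
  have g₁ := g.rot h₁
  have g₂ := g.rot h₂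
  obtain ⟨q, hq⟩ := ((g.addLeaf_del_iff false).2 (by simpa using hl)).exists_spineBelow
    (g.del.ne_nil hn)
  rw [h₁.lefts, Multiset.mem_cons, not_or] at hl
  have hl' := (h₁.lefts true).symm.trans (h₂.lefts true)
  rw [Multiset.cons_inj_right] at hl'
  have e₁ := (g₁.addLeaf_del_iff false).2 (by simp [hl])
  have e₂ := (g₂.addLeaf_del_iff false).2 (by simp [← hl', hl])
  rw [← hd] at e₂
  exact e₁.eq_of_spineBelow e₂ (fun hx => (g₁.del.lt hx).false) g₁.del.nodup
    ((h₁.spine_right _ _).2 hq) ((h₂.spine_right _ _).2 hq)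

/-- The labels determine every tree of a sequence of rotations that starts at the tree without
right edges. By induction this holds for the trees without the largest label `N`. The trees before
and after the rotation given by `N` are then determined, and from there on the position of `N` is
determined step by step, backwards and forwards. -/
theorem OnPath.unique {n : ℕ} (hn : 1 ≤ n) {L₁ L₂ : List (ℕ × ℕ)} (hL : ValidLabels n (L₁ ++ L₂))
    {u u' : BinaryTree ℕ} (h : OnPath n L₁ L₂ u) (h' : OnPath n L₁ L₂ u') : u = u' := by
  induction n, hn using Nat.le_induction generalizing L₁ L₂ u u' with
  | base =>
    have h0 : L₁ ++ L₂ = [] := by simpa using hL.1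
    obtain ⟨rfl, rfl⟩ := List.append_eq_nil_iff.1 h0
    exact h.1.symm.trans h'.1
  | succ n hn ih =>
    obtain ⟨A, a, B, hAB, ha1, han, hne, hval⟩ := hL.succ hn
    have hA : A.filter (fun p => decide (p.2 ≠ n + 1)) = A :=
      List.filter_eq_self.2 fun p hp => by simpa using hne p (List.mem_append_left _ hp)
    have hB : B.filter (fun p => decide (p.2 ≠ n + 1)) = B :=
      List.filter_eq_self.2 fun p hp => by simpa using hne p (List.mem_append_right _ hp)
    -- Without the largest label, the trees are determined by induction.
    have hdel : ∀ {M₁ M₂ u u'}, M₁ ++ M₂ = A ++ (a, n + 1) :: B → OnPath (n + 1) M₁ M₂ u →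
        OnPath (n + 1) M₁ M₂ u' → LabeledTree.del (n + 1) u = LabeledTree.del (n + 1) u' := by
      intro M₁ M₂ u u' hM h h'
      refine ih ?_ h.del h'.del
      rw [← List.filter_append, hM, List.filter_append, List.filter_cons_of_neg (by simp), hA, hB]
      exact hval
    -- the trees before and after the rotation given by the largest label
    have hmid : ∀ {w w'}, OnPath (n + 1) A ((a, n + 1) :: B) w →
        OnPath (n + 1) A ((a, n + 1) :: B) w' → w = w' := by
      intro w w' h h'
      obtain ⟨w₂, hr, -⟩ := h.next
      obtain ⟨w₂', hr', -⟩ := h'.next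
      exact (hr.unique_of_top hr' h.good.topLeaf h'.good.topLeaf h.good.nodup h'.good.nodup
        (by simpa using (by omega : a ≠ n + 1)) (hdel rfl h h')).1
    have hmid' : ∀ {w w'}, OnPath (n + 1) (A ++ [(a, n + 1)]) B w →
        OnPath (n + 1) (A ++ [(a, n + 1)]) B w' → w = w' := by
      intro w w' h h'
      obtain ⟨w₂, hr, h⟩ := h.prev
      obtain ⟨w₂', hr', h'⟩ := h'.prev
      exact (hr.unique_of_top hr' h.good.topLeaf h'.good.topLeaf h.good.nodup h'.good.nodup
        (by simpa using (by omega : a ≠ n + 1)) (hdel rfl h h')).2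
    -- the earlier trees, by going backwards
    have hback : ∀ (A₂ A₁ : List (ℕ × ℕ)) {u u'}, A = A₁ ++ A₂ →
        OnPath (n + 1) A₁ (A₂ ++ (a, n + 1) :: B) u →
        OnPath (n + 1) A₁ (A₂ ++ (a, n + 1) :: B) u' → u = u' := by
      intro A₂
      induction A₂ with
      | nil =>
        intro A₁ u u' e h h'
        obtain rfl : A = A₁ := by simpa using e
        exact hmid h h'
      | cons p A₂ ihA =>
        intro A₁ u u' e h h'
        obtain ⟨u₁, hr, k⟩ := h.next
        obtain ⟨u₁', hr', k'⟩ := h'.next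
        obtain rfl := ihA (A₁ ++ [p]) (by simpa using e) k k'
        refine hr.eq_of_left hn hr' h.good h'.good ?_ (hdel (by simp [e]) h h')
        obtain ⟨v, hv⟩ := k.2
        rw [hv.lefts]
        simp
    -- the later trees, by going forwards
    have hforw : ∀ (B₁ B₂ : List (ℕ × ℕ)) {u u'}, B = B₁ ++ B₂ →
        OnPath (n + 1) (A ++ (a, n + 1) :: B₁) B₂ u →
        OnPath (n + 1) (A ++ (a, n + 1) :: B₁) B₂ u' → u = u' := by
      intro B₁
      induction B₁ using List.reverseRecOn with
      | nil =>
        intro B₂ u u' e h h'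
        obtain rfl : B = B₂ := by simpa using e
        exact hmid' h h'
      | append_singleton B₁ p ihB =>
        intro B₂ u u' e h h'
        have hd := hdel (by simp [e]) h h'
        rw [← List.cons_append, ← List.append_assoc] at h h'
        obtain ⟨w, hr, k⟩ := h.prev
        obtain ⟨w', hr', k'⟩ := h'.prev
        obtain rfl := ihB (p :: B₂) (by simpa using e) k k'
        refine hr.eq_of_right hn hr' k.good ?_ hd
        -- The largest label occurs only once as a left child of the initial tree, and it has
        -- been used up among the labels so far.
        have h1 := (k.1.lefts true).symm.trans (lefts_bot (n + 1))
        have h2 : (List.range' 1 (n + 1)).Nodup := List.nodup_range'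
        rw [← Multiset.coe_nodup, ← h1] at h2
        intro hx
        exact Multiset.disjoint_left.1 (Multiset.nodup_add.1 h2).2.2 (by simp) hx
    rw [List.append_eq_append_iff] at hAB
    rcases hAB with ⟨C, e1, e2⟩ | ⟨C, e1, e2⟩
    · subst e2
      exact hback _ _ e1 h h'
    · cases C with
      | nil =>
        obtain rfl : L₁ = A := by simpa using e1
        obtain rfl : (a, n + 1) :: B = L₂ := by simpa using e2
        exact hmid h h'
      | cons p C =>
        simp only [List.cons_append, List.cons.injEq] at e2
        obtain ⟨rfl, e2⟩ := e2
        subst e1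
        exact hforw _ _ e2 h h'

/-! ### The two descriptions of rotations agree -/

theorem split_filter (S : Finset ℕ) (m : BinaryTree ℕ) :
    Split m (ofLeftSeq ((leftSeq m).filter (fun x => decide (x.1 ∉ S))))
      (ofLeftSeq ((leftSeq m).filter (fun x => decide (x.1 ∈ S)))) := by
  induction m with
  | nil => exact .nil
  | node a l r ihl _ =>
    by_cases ha : a ∈ S
    · simpa [leftSeq, ha, ofLeftSeq] using ihl.take
    · simpa [leftSeq, ha, ofLeftSeq] using ihl.keep

theorem mem_of_mem_leftSeq {x : ℕ × BinaryTree ℕ} {m : BinaryTree ℕ} (h : x ∈ leftSeq m) :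
    x.1 ∈ inorder m := by
  induction m with
  | nil => simp [leftSeq] at h
  | node a l r ihl _ =>
    simp only [leftSeq, List.mem_cons] at h
    simp only [inorder, List.mem_append, List.mem_cons]
    rcases h with rfl | h
    · exact Or.inr (Or.inl rfl)
    · exact Or.inl (ihl h)

theorem Split.exists_filter {m m' m'' : BinaryTree ℕ} (h : Split m m' m'')
    (hn : (inorder m).Nodup) :
    ∃ S ⊆ ((leftSeq m).map Prod.fst).toFinset,
      m' = ofLeftSeq ((leftSeq m).filter (fun x => decide (x.1 ∉ S))) ∧
      m'' = ofLeftSeq ((leftSeq m).filter (fun x => decide (x.1 ∈ S))) := by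
  have aux : ∀ {S : Finset ℕ} {m : BinaryTree ℕ} {a : ℕ},
      S ⊆ ((leftSeq m).map Prod.fst).toFinset → a ∉ inorder m → a ∉ S := fun hS ha h => by
    have := hS h
    rw [List.mem_toFinset, List.mem_map] at this
    obtain ⟨x, hx, rfl⟩ := this
    exact ha (mem_of_mem_leftSeq hx)
  induction h with
  | nil => exact ⟨∅, by simp, rfl, rfl⟩
  | @keep a l l' l'' r h ih =>
    obtain ⟨n1, n2, n3, n4, n5⟩ := nodup_inorder_node.1 hn
    obtain ⟨S, hS, e1, e2⟩ := ih n1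
    have ha := aux hS n3
    refine ⟨S, fun x hx => ?_, ?_, ?_⟩
    · have := hS hx
      simp only [leftSeq, List.map_cons, List.toFinset_cons, Finset.mem_insert]
      exact Or.inr this
    · rw [leftSeq, List.filter_cons_of_pos (by simpa using ha), ofLeftSeq, ← e1]
    · rw [leftSeq, List.filter_cons_of_neg (by simpa using ha), ← e2]
  | @take a l l' l'' r h ih =>
    obtain ⟨n1, n2, n3, n4, n5⟩ := nodup_inorder_node.1 hn
    obtain ⟨S, hS, e1, e2⟩ := ih n1
    have hne : ∀ x ∈ leftSeq l, x.1 ≠ a := fun x hx h => n3 (h ▸ mem_of_mem_leftSeq hx)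
    refine ⟨insert a S, fun x hx => ?_, ?_, ?_⟩
    · simp only [leftSeq, List.map_cons, List.toFinset_cons, Finset.mem_insert] at hx ⊢
      exact hx.imp_right fun h => hS h
    · rw [leftSeq, List.filter_cons_of_neg (by simp), e1]
      congr 1
      exact List.filter_congr fun x hx => by simp [hne x hx]
    · rw [leftSeq, List.filter_cons_of_pos (by simp), ofLeftSeq, e2]
      congr 2
      exact List.filter_congr fun x hx => by simp [hne x hx]

theorem IsSubtree.mem {s t : BinaryTree ℕ} (h : IsSubtree s t) {x : ℕ} (hx : x ∈ inorder s) :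
    x ∈ inorder t := by
  induction t with
  | nil =>
    obtain rfl : s = nil := h
    exact hx
  | node a l r ihl ihr =>
    rcases h with rfl | h | h
    · exact hx
    · simp [inorder, ihl h]
    · simp [inorder, ihr h]

theorem IsSubtree.mem_root {c : ℕ} {l r t : BinaryTree ℕ} (h : IsSubtree (node c l r) t) :
    c ∈ inorder t := h.mem (by simp [inorder])

theorem IsSubtree.mem_left {c x : ℕ} {l r t : BinaryTree ℕ} (h : IsSubtree (node c l r) t)
    (hx : x ∈ inorder l) : x ∈ inorder t := h.mem (by simp [inorder, hx])

theorem IsSubtree.mem_right {c x : ℕ} {l r t : BinaryTree ℕ} (h : IsSubtree (node c l r) t)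
    (hx : x ∈ inorder r) : x ∈ inorder t := h.mem (by simp [inorder, hx])

theorem Replace.mem {s s' t t' : BinaryTree ℕ} (h : Replace s s' t t') {x : ℕ}
    (hx : x ∈ inorder s) : x ∈ inorder t := by
  induction h with
  | here => exact hx
  | left _ ih => simp [inorder, ih]
  | right _ ih => simp [inorder, ih]

theorem Replace.mem_of_mem {s s' t t' : BinaryTree ℕ} (h : Replace s s' t t')
    (hs : ∀ x ∈ inorder s', x ∈ inorder s) : ∀ x ∈ inorder t', x ∈ inorder t := by
  induction h with
  | here => exact hs
  | left _ ih => simp only [inorder, List.mem_append, List.mem_cons]; grind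
  | right _ ih => simp only [inorder, List.mem_append, List.mem_cons]; grind

theorem Extract.le_of_isSubtree {b : ℕ} {σ : Bool} {l l' s : BinaryTree ℕ}
    (h : Extract b σ l l' s) (hn : (inorder l).Nodup) {c y : ℕ} {lc rc : BinaryTree ℕ}
    (hc : IsSubtree (node c lc rc) l) (hb : b ∈ inorder lc) (hy : y ∈ inorder rc) : b ≤ y := by
  induction h with
  | root h =>
    obtain ⟨n1, n2, n3, n4, n5⟩ := nodup_inorder_node.1 hn
    rcases hc with hc | hc | hc
    · simp only [node.injEq] at hc
      obtain ⟨-, rfl, -⟩ := hc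
      exact absurd hb n3
    · exact absurd (hc.mem_left hb) n3
    · exact absurd (hc.mem_left hb) n4
  | left h hr ih =>
    obtain ⟨n1, n2, n3, n4, n5⟩ := nodup_inorder_node.1 hn
    rcases hc with hc | hc | hc
    · simp only [node.injEq] at hc
      obtain ⟨-, -, rfl⟩ := hc
      exact hr y hy
    · exact ih n1 hc
    · exact absurd (hc.mem_left hb) (n5 b h.mem)
  | right h ih =>
    obtain ⟨n1, n2, n3, n4, n5⟩ := nodup_inorder_node.1 hn
    rcases hc with hc | hc | hc
    · simp only [node.injEq] at hc
      obtain ⟨-, rfl, -⟩ := hc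
      exact absurd h.mem (n5 b hb)
    · exact absurd h.mem (n5 b (hc.mem_left hb))
    · exact ih n2 hc

theorem Extract.exists_replace {b : ℕ} {σ : Bool} {l l' s : BinaryTree ℕ}
    (h : Extract b σ l l' s) (hn : (inorder l).Nodup) :
    (∃ m u m'', l = node b m u ∧ Split m l' m'' ∧ s = node b m'' u ∧ (inorder m).Nodup) ∨
    ∃ p m u v m' m'', Replace (node p (node b m u) v) (node p m' v) l l' ∧ Split m m' m'' ∧
      s = node b m'' u ∧ (inorder m).Nodup := by
  induction h with
  | root h => exact Or.inl ⟨_, _, _, rfl, h, rfl, (nodup_inorder_node.1 hn).1⟩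
  | left h hr ih =>
    refine Or.inr ?_
    rcases ih (nodup_inorder_node.1 hn).1 with
      ⟨m, u, m'', rfl, h1, h2, h3⟩ | ⟨p, m, u, v, m', m'', h0, h1, h2, h3⟩
    · exact ⟨_, _, _, _, _, _, .here, h1, h2, h3⟩
    · exact ⟨_, _, _, _, _, _, .left h0, h1, h2, h3⟩
  | right h ih =>
    refine Or.inr ?_
    rcases ih (nodup_inorder_node.1 hn).2.1 with
      ⟨m, u, m'', rfl, h1, h2, h3⟩ | ⟨p, m, u, v, m', m'', h0, h1, h2, h3⟩
    · have n := nodup_inorder_node.1 (nodup_inorder_node.1 hn).2.1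
      cases h with
      | left h hr => exact absurd h.mem n.2.2.1
      | right h => exact absurd h.mem n.2.2.2.1
    · exact ⟨_, _, _, _, _, _, .right h0, h1, h2, h3⟩

theorem extract_of_replace {b p : ℕ} {m m' m'' u v l l' : BinaryTree ℕ} (hm : Split m m' m'')
    (h : Replace (node p (node b m u) v) (node p m' v) l l')
    (hl : ∀ c lc rc y, IsSubtree (node c lc rc) l → b ∈ inorder lc → y ∈ inorder rc → b ≤ y)
    (σ : Bool) : Extract b σ l l' (node b m'' u) := by
  induction h generalizing σ with
  | here =>
    exact (Extract.root hm).left fun y hy =>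
      hl p (node b m u) v y (Or.inl rfl) (by simp [inorder]) hy
  | left h ih =>
    refine (ih (fun c lc rc y hc => hl c lc rc y (Or.inr (Or.inl hc))) true).left fun y hy => ?_
    exact hl _ _ _ y (Or.inl rfl) (h.mem (by simp [inorder])) hy
  | right h ih =>
    exact (ih (fun c lc rc y hc => hl c lc rc y (Or.inr (Or.inr hc))) false).right

theorem Rot.rotatesTo {a b : ℕ} {t t' : BinaryTree ℕ} (h : Rot a b t t')
    (hn : (inorder t).Nodup) : RotatesTo t t' a b := by
  induction h with
  | @here l l' r s h =>
    obtain ⟨n1, n2, n3, n4, n5⟩ := nodup_inorder_node.1 hn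
    refine ⟨⟨⟨l, r, Or.inl rfl, h.mem⟩, ?_⟩, ?_⟩
    · rintro y c hy ⟨lc, rc, hc, hbc, hyc⟩ ⟨la, ra, ha, hca⟩
      rcases ha with ha | ha | ha
      · simp only [node.injEq, true_and] at ha
        obtain ⟨rfl, rfl⟩ := ha
        rcases hc with hc | hc | hc
        · simp only [node.injEq] at hc
          obtain ⟨rfl, -, -⟩ := hc
          exact hca.elim n3 n4
        · exact (h.le_of_isSubtree n1 hc hbc hyc).not_gt hy
        · exact n5 b h.mem (hc.mem_left hbc)
      · exact n3 ha.mem_root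
      · exact n4 ha.mem_root
    · rcases h.exists_replace n1 with
        ⟨m, u, m'', rfl, h1, rfl, h3⟩ | ⟨p, m, u, v, m', m'', h0, h1, rfl, h3⟩
      · obtain ⟨S, hS, e1, e2⟩ := h1.exists_filter h3
        subst e1 e2
        exact ⟨a, m, u, r, S, _, _, _, r, hS, rfl, .here, .here⟩
      · obtain ⟨S, hS, e1, e2⟩ := h1.exists_filter h3
        subst e1 e2
        exact ⟨p, m, u, v, S, _, _, l', r, hS, rfl, .left h0, .here⟩
  | @left c l l' r h ih =>
    obtain ⟨n1, n2, n3, n4, n5⟩ := nodup_inorder_node.1 hn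
    obtain ⟨⟨⟨la, ra, ha, hba⟩, hadm⟩, p, m, u, v, S, t₁, t₂, x, y, hS, h1, h2, h3⟩ := ih n1
    refine ⟨⟨⟨la, ra, Or.inr (Or.inl ha), hba⟩, ?_⟩,
      p, m, u, v, S, t₁, _, x, y, hS, h1, .left h2, .left h3⟩
    rintro y d hy ⟨ld, rd, hd, hbd, hyd⟩ ⟨la', ra', ha', hda⟩
    have hs : IsSubtree (node a la' ra') l := by
      rcases ha' with ha' | ha' | ha'
      · simp only [node.injEq] at ha'
        exact absurd (ha'.1 ▸ h.mem_left) n3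
      · exact ha'
      · exact absurd ha'.mem_root (n5 a h.mem_left)
    rcases hd with hd | hd | hd
    · simp only [node.injEq] at hd
      obtain ⟨rfl, -, -⟩ := hd
      rcases hda with hda | hda
      · exact n3 (hs.mem_left hda)
      · exact n3 (hs.mem_right hda)
    · exact hadm y d hy ⟨ld, rd, hd, hbd, hyd⟩ ⟨la', ra', hs, hda⟩
    · exact n5 b h.mem_right (hd.mem_left hbd)
  | @right c l r r' h ih =>
    obtain ⟨n1, n2, n3, n4, n5⟩ := nodup_inorder_node.1 hn
    obtain ⟨⟨⟨la, ra, ha, hba⟩, hadm⟩, p, m, u, v, S, t₁, t₂, x, y, hS, h1, h2, h3⟩ := ih n2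
    refine ⟨⟨⟨la, ra, Or.inr (Or.inr ha), hba⟩, ?_⟩,
      p, m, u, v, S, t₁, _, x, y, hS, h1, .right h2, .right h3⟩
    rintro y d hy ⟨ld, rd, hd, hbd, hyd⟩ ⟨la', ra', ha', hda⟩
    have hs : IsSubtree (node a la' ra') r := by
      rcases ha' with ha' | ha' | ha'
      · simp only [node.injEq] at ha'
        exact absurd (ha'.1 ▸ h.mem_left) n4
      · exact absurd h.mem_left (n5 a ha'.mem_root)
      · exact ha'
    rcases hd with hd | hd | hd
    · simp only [node.injEq] at hd
      obtain ⟨rfl, -, -⟩ := hd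
      rcases hda with hda | hda
      · exact n4 (hs.mem_left hda)
      · exact n4 (hs.mem_right hda)
    · exact n5 b (hd.mem_left hbd) h.mem_right
    · exact hadm y d hy ⟨ld, rd, hd, hbd, hyd⟩ ⟨la', ra', hs, hda⟩

theorem RotatesTo.rot {a b : ℕ} {t t' : BinaryTree ℕ} (h : RotatesTo t t' a b)
    (hn : (inorder t).Nodup) : Rot a b t t' := by
  obtain ⟨⟨hleft, hadm⟩, p, m, u, v, S, t₁, t₂, l, r, hS, rfl, h1, h2⟩ := h
  have hsplit := split_filter S m
  revert h1 h2 hsplit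
  generalize ofLeftSeq ((leftSeq m).filter (fun x => decide (x.1 ∉ S))) = m'
  generalize ofLeftSeq ((leftSeq m).filter (fun x => decide (x.1 ∈ S))) = m''
  intro h1 h2 hsplit
  have hb : ∀ {t t₂}, Replace (node p (node b m u) v) (node p m' v) t t₂ → b ∈ inorder t :=
    fun h => h.mem (by simp [inorder])
  have hsub : ∀ x ∈ inorder (node p m' v), x ∈ inorder (node p (node b m u) v) := by
    intro x hx
    simp only [inorder, List.mem_append, List.mem_cons] at hx ⊢
    have := hsplit.perm.mem_iff (a := x)
    rw [List.mem_append] at this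
    tauto
  have ha : ∀ {t t₂}, Replace (node a l r) (node a l (mergeRight (node b m'' u) r)) t t₂ →
      a ∈ inorder t := fun h => h.mem (by simp [inorder])
  induction t generalizing t' t₂ with
  | nil => cases h1
  | node c tl tr ihl ihr =>
    obtain ⟨n1, n2, n3, n4, n5⟩ := nodup_inorder_node.1 hn
    cases h1 with
    | here =>
      obtain ⟨n6, n7, n8, n9, n10⟩ := nodup_inorder_node.1 n1
      have hap : a = p := by
        obtain ⟨la, ra, hs, hba⟩ := hleft
        rcases hs with hs | hs | hs
        · simp only [node.injEq] at hs
          exact hs.1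
        · rcases hs with hs | hs | hs
          · simp only [node.injEq] at hs
            obtain ⟨-, rfl, -⟩ := hs
            exact absurd hba n8
          · exact absurd (hs.mem_left hba) n8
          · exact absurd (hs.mem_left hba) n9
        · exact absurd (hs.mem_left hba) (n5 b (by simp [inorder]))
      subst hap
      have hm' : a ∉ inorder m' := fun h => n3 (by
        simp only [inorder, List.mem_append]
        exact Or.inl (hsplit.perm.mem_iff.2 (List.mem_append_left _ h)))
      cases h2 with
      | here => exact .here (.root hsplit)
      | left h2 => exact absurd (ha h2) hm'
      | right h2 => exact absurd (ha h2) n4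
    | left h1 =>
      cases h2 with
      | here =>
        refine .here (extract_of_replace hsplit h1 ?_ true)
        intro d ld rd y hd hbd hyd
        by_contra hy
        exact hadm y d (not_le.1 hy) ⟨ld, rd, Or.inr (Or.inl hd), hbd, hyd⟩
          ⟨_, _, Or.inl rfl, Or.inl hd.mem_root⟩
      | left h2 =>
        have hal := h1.mem_of_mem hsub a (ha h2)
        refine .left (ihl n1 ?_ ?_ _ h1 h2)
        · obtain ⟨la, ra, hs, hba⟩ := hleft
          rcases hs with hs | hs | hs
          · simp only [node.injEq] at hs
            exact absurd (hs.1 ▸ hal) n3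
          · exact ⟨la, ra, hs, hba⟩
          · exact absurd hs.mem_root (n5 a hal)
        · rintro y d hy ⟨ld, rd, hd, hbd⟩ ⟨la, ra, hs, hda⟩
          exact hadm y d hy ⟨ld, rd, Or.inr (Or.inl hd), hbd⟩ ⟨la, ra, Or.inr (Or.inl hs), hda⟩
      | right h2 =>
        obtain ⟨la, ra, hs, hba⟩ := hleft
        rcases hs with hs | hs | hs
        · simp only [node.injEq] at hs
          exact absurd (hs.1 ▸ ha h2) n4
        · exact absurd (ha h2) (n5 a hs.mem_root)
        · exact absurd (hs.mem_left hba) (n5 b (hb h1))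
    | right h1 =>
      cases h2 with
      | here =>
        obtain ⟨la, ra, hs, hba⟩ := hleft
        rcases hs with hs | hs | hs
        · simp only [node.injEq] at hs
          obtain ⟨-, rfl, -⟩ := hs
          exact absurd (hb h1) (n5 b hba)
        · exact absurd hs.mem_root n3
        · exact absurd hs.mem_root n4
      | left h2 =>
        obtain ⟨la, ra, hs, hba⟩ := hleft
        rcases hs with hs | hs | hs
        · simp only [node.injEq] at hs
          exact absurd (hs.1 ▸ ha h2) n3
        · exact absurd (hb h1) (n5 b (hs.mem_left hba))
        · exact absurd hs.mem_root (n5 a (ha h2))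
      | right h2 =>
        have hal := h1.mem_of_mem hsub a (ha h2)
        refine .right (ihr n2 ?_ ?_ _ h1 h2)
        · obtain ⟨la, ra, hs, hba⟩ := hleft
          rcases hs with hs | hs | hs
          · simp only [node.injEq] at hs
            exact absurd (hs.1 ▸ hal) n4
          · exact absurd hal (n5 a hs.mem_root)
          · exact ⟨la, ra, hs, hba⟩
        · rintro y d hy ⟨ld, rd, hd, hbd⟩ ⟨la, ra, hs, hda⟩
          exact hadm y d hy ⟨ld, rd, Or.inr (Or.inr hd), hbd⟩ ⟨la, ra, Or.inr (Or.inr hs), hda⟩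

theorem rotatesTo_iff_rot {a b : ℕ} {t t' : BinaryTree ℕ} (hn : (inorder t).Nodup) :
    RotatesTo t t' a b ↔ Rot a b t t' :=
  ⟨fun h => h.rot hn, fun h => h.rotatesTo hn⟩

/-! ### Trees of noncommutative crossing partitions -/

theorem exists_increasing (w : List ℕ) (hw : w.Nodup) :
    ∃ t, Increasing t ∧ inorder t = w := by
  induction h : w.length using Nat.strong_induction_on generalizing w with
  | _ k ih =>
    by_cases hnil : w = []
    · exact ⟨nil, trivial, hnil.symm⟩
    obtain ⟨a, ha, hmin⟩ := w.toFinset.exists_min_image id (by simpa using hnil)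
    simp only [List.mem_toFinset, id] at ha hmin
    obtain ⟨s, t, rfl⟩ := List.append_of_mem ha
    simp only [List.length_append, List.length_cons] at h
    rw [List.nodup_append, List.nodup_cons] at hw
    obtain ⟨h1, ⟨h2, h3⟩, h4⟩ := hw
    obtain ⟨l, hl, rfl⟩ := ih _ (by omega) s h1 rfl
    obtain ⟨r, hr, rfl⟩ := ih _ (by omega) t h3 rfl
    refine ⟨node a l r, ⟨fun x hx => ?_, fun x hx => ?_, hl, hr⟩, rfl⟩
    · exact lt_of_le_of_ne (hmin x (by simp [hx])) (h4 x hx a (by simp)).symm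
    · exact lt_of_le_of_ne (hmin x (by simp [hx])) fun h => h2 (h ▸ hx)

end LabeledTree

namespace NCCP

open LabeledTree

variable {n : ℕ}

theorem nodup_word (π : NCCP n) : π.word.Nodup := π.perm_range.nodup_iff.2 List.nodup_range'

theorem exists_isTree (π : NCCP n) : ∃ t, π.IsTree t := exists_increasing _ π.nodup_word

/-- The labeled binary tree of a noncommutative crossing partition. -/
noncomputable def tree (π : NCCP n) : BinaryTree ℕ := π.exists_isTree.choose

theorem isTree_tree (π : NCCP n) : π.IsTree π.tree := π.exists_isTree.choose_spec

theorem good_tree (π : NCCP n) : Good n π.tree :=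
  ⟨π.isTree_tree.1, π.isTree_tree.2 ▸ π.perm_range⟩

theorem coverLabel_iff {π π' : NCCP n} {a b : ℕ} :
    CoverLabel π π' a b ↔ Rot a b π.tree π'.tree := by
  rw [← rotatesTo_iff_rot π.good_tree.nodup]
  constructor
  · rintro ⟨t, t', h1, h2, h⟩
    rwa [π.isTree_tree.unique h1, π'.isTree_tree.unique h2]
  · exact fun h => ⟨_, _, π.isTree_tree, π'.isTree_tree, h⟩

/-- The blocks are the maximal increasing runs of the word. -/
theorem blocks_eq_splitBy (π : NCCP n) :
    π.blocks = π.word.splitBy fun x y => decide (x < y) := by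
  refine (List.splitBy_flatten (fun h => π.blocks_ne_nil _ h rfl) (fun B hB => ?_) ?_).symm
  · simpa using (π.blocks_increasing B hB).isChain
  · refine π.max_gt_min.imp_of_mem_imp fun B C hB hC ⟨x, hx, y, hy, hyx⟩ => ?_
    have hB' := π.blocks_ne_nil B hB
    have hC' := π.blocks_ne_nil C hC
    refine ⟨hB', hC', ?_⟩
    have h1 : x ≤ B.getLast hB' := by
      obtain ⟨s, t, rfl⟩ := List.append_of_mem hx
      have h2 := (List.pairwise_append.1 (π.blocks_increasing _ hB)).2.1
      rw [List.getLast_append_of_ne_nil _ (by simp)]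
      rcases List.mem_cons.1 (List.getLast_mem (l := x :: t) (by simp)) with h | h
      · exact h.ge
      · exact ((List.pairwise_cons.1 h2).1 _ h).le
    have h2 : C.head hC' ≤ y := by
      have h2 := π.blocks_increasing _ hC
      cases C with
      | nil => exact absurd rfl hC'
      | cons z C =>
        rcases List.mem_cons.1 hy with rfl | h
        · exact le_rfl
        · exact ((List.pairwise_cons.1 h2).1 _ h).le
    simpa using h2.trans (hyx.le.trans h1)

theorem tree_injective : Function.Injective (tree (n := n)) := by
  intro π π' h
  have hw : π.word = π'.word := by rw [← π.isTree_tree.2, ← π'.isTree_tree.2, h]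
  ext1
  rw [blocks_eq_splitBy, blocks_eq_splitBy, hw]

theorem exists_tree_eq {t : BinaryTree ℕ} (ht : Good n t) : ∃ π : NCCP n, π.tree = t := by
  have hn := ht.nodup
  let r : ℕ → ℕ → Bool := fun x y => decide (x < y)
  have hf := List.flatten_splitBy r (inorder t)
  have hdisj := (List.nodup_flatten.1 (hf.symm ▸ hn)).2
  refine ⟨⟨(inorder t).splitBy r, fun B hB => List.ne_nil_of_mem_splitBy hB, fun B hB => ?_, ?_,
    ?_⟩, ?_⟩
  · rw [← List.isChain_iff_pairwise]
    simpa [r] using List.isChain_of_mem_splitBy hB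
  · rw [hf]; exact ht.2
  · have h1 := List.isChain_getLast_head_splitBy r (inorder t)
    have h2 := hdisj.isChain
    rw [List.isChain_iff_getElem] at *
    intro i hi
    obtain ⟨ha, hb, h3⟩ := h1 i hi
    refine ⟨_, List.getLast_mem ha, _, List.head_mem hb, ?_⟩
    refine lt_of_le_of_ne (by simpa [r] using h3) fun e => ?_
    exact h2 i hi (List.getLast_mem ha) (e ▸ List.head_mem hb)
  · exact IsTree.unique (isTree_tree _) ⟨ht.1, hf.symm⟩

/-- The number of left children, where the root counts as one. -/
noncomputable def leftCard (π : NCCP n) : ℕ := Multiset.card (lefts true π.tree)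

theorem leftCard_le (π : NCCP n) : π.leftCard ≤ n := by
  have key : ∀ (σ : Bool) (t : BinaryTree ℕ),
      Multiset.card (lefts σ t) ≤ (inorder t).length := by
    intro σ t
    induction t generalizing σ with
    | nil => simp [lefts]
    | node a l r ihl ihr =>
      have h1 := ihl true
      have h2 := ihr false
      cases σ <;> simp [lefts, inorder] <;> omega
  simpa [leftCard, π.good_tree.2.length_eq] using key true π.tree

theorem Cover.leftCard {π π' : NCCP n} (h : Cover π π') : π.leftCard = π'.leftCard + 1 := by
  obtain ⟨a, b, h⟩ := h
  rw [coverLabel_iff] at h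
  rw [NCCP.leftCard, h.lefts, Multiset.card_cons, NCCP.leftCard]

theorem Cover.le {π π' : NCCP n} (h : Cover π π') : π ≤ π' := Relation.ReflTransGen.single h

theorem leftCard_anti {π π' : NCCP n} (h : π ≤ π') : π'.leftCard ≤ π.leftCard := by
  induction (h : Relation.ReflTransGen Cover π π') with
  | refl => exact le_rfl
  | tail _ hc ih => have := hc.leftCard; omega

theorem exists_cover_of_lt {π π' : NCCP n} (h : π < π') : ∃ ρ, Cover π ρ ∧ ρ ≤ π' := by
  rcases Relation.ReflTransGen.cases_head (h.le : Relation.ReflTransGen Cover π π') with h' | h'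
  · exact absurd h' h.ne
  · exact h'

theorem Cover.lt {π π' : NCCP n} (h : Cover π π') : π < π' :=
  lt_of_le_of_ne h.le fun e => by
    have := h.leftCard
    rw [e] at this
    omega

theorem leftCard_lt {π π' : NCCP n} (h : π < π') : π'.leftCard < π.leftCard := by
  obtain ⟨ρ, h1, h2⟩ := exists_cover_of_lt h
  have := h1.leftCard
  have := leftCard_anti h2
  omega

theorem eq_of_leftCard_eq {s : Set (NCCP n)} (hs : IsChain (· ≤ ·) s) {π π' : NCCP n}
    (h : π ∈ s) (h' : π' ∈ s) (he : π.leftCard = π'.leftCard) : π = π' := by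
  rcases hs.total h h' with hle | hle
  · exact hle.eq_or_lt.resolve_right fun hlt => by have := leftCard_lt hlt; omega
  · exact (hle.eq_or_lt.resolve_right fun hlt => by have := leftCard_lt hlt; omega).symm

/-- The tree without right edges belongs to the least element. -/
theorem bot_le {π₀ : NCCP n} (h₀ : π₀.tree = bot n) (π : NCCP n) : π₀ ≤ π := by
  induction h : n - π.leftCard using Nat.strong_induction_on generalizing π with
  | _ k ih =>
    by_cases hb : π.tree = bot n
    · exact (tree_injective (h₀.trans hb.symm)).le
    · obtain ⟨a, b, t, ht, hr⟩ := exists_rot_of_ne_bot π.good_tree hb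
      obtain ⟨ρ, rfl⟩ := exists_tree_eq ht
      have hc : Cover ρ π := ⟨a, b, coverLabel_iff.2 hr⟩
      have h1 := hc.leftCard
      have h2 := ρ.leftCard_le
      exact (ih _ (by omega) ρ rfl).trans hc.le

theorem exists_cover (hn : 1 ≤ n) {π : NCCP n} (h : 2 ≤ π.leftCard) : ∃ ρ, Cover π ρ := by
  have : lefts false π.tree ≠ 0 := by
    intro h0
    rw [leftCard] at h
    cases ht : π.tree with
    | nil => exact π.good_tree.ne_nil hn ht
    | node a l r =>
      rw [ht] at h h0
      simp only [lefts] at h h0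
      simp at h h0
      simp [h0] at h
  obtain ⟨a, b, t, hr⟩ := exists_rot_of_lefts_ne this
  obtain ⟨ρ, rfl⟩ := exists_tree_eq (π.good_tree.rot hr)
  exact ⟨ρ, a, b, coverLabel_iff.2 hr⟩

theorem one_le_leftCard (hn : 1 ≤ n) (π : NCCP n) : 1 ≤ π.leftCard := by
  rw [leftCard]
  cases ht : π.tree with
  | nil => exact absurd ht (π.good_tree.ne_nil hn)
  | node a l r => simp [lefts]

/-! ### Maximal chains -/

theorem mem_flag {c : Flag (NCCP n)} {π : NCCP n} (h : ∀ ρ ∈ c, ρ ≤ π ∨ π ≤ ρ) : π ∈ c := by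
  have h1 : IsChain (· ≤ ·) (insert π (c : Set (NCCP n))) :=
    c.chain_le.insert fun ρ hρ _ => (h ρ hρ).symm
  have h2 := c.max_chain' h1 (Set.subset_insert _ _)
  have : π ∈ c.carrier := h2 ▸ Set.mem_insert _ _
  exact this

theorem exists_cover_mem_flag (hn : 1 ≤ n) {c : Flag (NCCP n)} {π : NCCP n} (hπ : π ∈ c)
    (h : 2 ≤ π.leftCard) : ∃ ρ ∈ c, Cover π ρ := by
  obtain ⟨ρ, hc, hρ⟩ : ∃ ρ, Cover π ρ ∧ ∀ ω ∈ c, ω ≤ π ∨ ρ ≤ ω := by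
    by_cases hex : ∃ ω ∈ c, π < ω
    · -- a least element of the chain above `π`
      obtain ⟨ω, ⟨hω, hlt⟩, hmin⟩ := (measure fun ω : NCCP n => n - ω.leftCard).wf.has_min
        {ω | ω ∈ c ∧ π < ω} hex
      obtain ⟨ρ, hc, hρ⟩ := exists_cover_of_lt hlt
      refine ⟨ρ, hc, fun ξ hξ => ?_⟩
      rcases c.chain_le.total hξ hπ with hle | hle
      · exact Or.inl hle
      rcases hle.eq_or_lt with rfl | hlt'
      · exact Or.inl le_rfl
      rcases c.chain_le.total hω hξ with h1 | h1
      · exact Or.inr (hρ.trans h1)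
      rcases h1.eq_or_lt with rfl | h1
      · exact Or.inr hρ
      refine absurd ?_ (hmin ξ ⟨hξ, hlt'⟩)
      have h2 := leftCard_lt h1
      have h3 := ξ.leftCard_le
      change n - ξ.leftCard < n - ω.leftCard
      omega
    · obtain ⟨ρ, hc⟩ := exists_cover hn h
      refine ⟨ρ, hc, fun ω hω => Or.inl ?_⟩
      rcases c.chain_le.total hω hπ with hle | hle
      · exact hle
      · exact (hle.eq_or_lt.resolve_right fun hlt => hex ⟨ω, hω, hlt⟩).ge
  exact ⟨ρ, mem_flag fun ω hω => (hρ ω hω).imp_left fun h => h.trans hc.le, hc⟩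

theorem leftCard_bot {π₀ : NCCP n} (h₀ : π₀.tree = bot n) : π₀.leftCard = n := by
  rw [leftCard, h₀, lefts_bot]
  simp

theorem leftCard_apply {m : ℕ} {f : Fin (m + 1) → NCCP n} (h₀ : (f 0).tree = bot n)
    (hf : ∀ i : Fin m, Cover (f i.castSucc) (f i.succ)) (i : Fin (m + 1)) :
    (f i).leftCard + i = n := by
  induction i using Fin.induction with
  | zero => simpa using leftCard_bot h₀
  | succ i ih =>
    have := (hf i).leftCard
    simp only [Fin.val_castSucc, Fin.val_succ] at *
    omega

/-- A saturated chain from the least element with `n` members is a maximal chain: each number of left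
children occurs in it, and comparable elements with the same number are equal. -/
theorem eq_range_of_chain (hn : 1 ≤ n) {f : Fin (n - 1 + 1) → NCCP n}
    (h₀ : (f 0).tree = bot n) (hf : ∀ i : Fin (n - 1), Cover (f i.castSucc) (f i.succ))
    {s : Set (NCCP n)} (hs : IsChain (· ≤ ·) s) (hfs : Set.range f ⊆ s) : Set.range f = s := by
  refine hfs.antisymm fun π hπ => ?_
  have h1 := one_le_leftCard hn π
  have h2 := π.leftCard_le
  let i : Fin (n - 1 + 1) := ⟨n - π.leftCard, by omega⟩
  refine ⟨i, eq_of_leftCard_eq hs (hfs ⟨i, rfl⟩) hπ ?_⟩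
  have h3 := leftCard_apply h₀ hf i
  simp only [i] at h3 ⊢
  omega

/-- Maximal chains are saturated and start at the least element. -/
theorem exists_range_eq_flag (hn : 1 ≤ n) (c : Flag (NCCP n)) :
    ∃ f : Fin (n - 1 + 1) → NCCP n, (f 0).tree = bot n ∧
      (∀ i : Fin (n - 1), Cover (f i.castSucc) (f i.succ)) ∧ Set.range f = c := by
  obtain ⟨π₀, h₀⟩ := exists_tree_eq (good_bot n)
  have hmem : π₀ ∈ c := mem_flag fun ρ _ => Or.inr (bot_le h₀ ρ)
  have hex : ∀ π : c, ∃ ρ : c, 2 ≤ π.1.leftCard → Cover π.1 ρ.1 := fun π => by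
    by_cases h : 2 ≤ π.1.leftCard
    · obtain ⟨ρ, h1, h2⟩ := exists_cover_mem_flag hn π.2 h
      exact ⟨⟨ρ, h1⟩, fun _ => h2⟩
    · exact ⟨π, fun h' => absurd h' h⟩
  choose next hnext using hex
  let g : ℕ → c := fun i => next^[i] ⟨π₀, hmem⟩
  have hg : ∀ i, i < n → (g i).1.leftCard = n - i := by
    intro i
    induction i with
    | zero => intro _; simpa [g] using leftCard_bot h₀
    | succ i ih =>
      intro hi
      have h1 := ih (by omega)
      have h2 := (hnext (g i) (by omega)).leftCard
      have h3 : g (i + 1) = next (g i) := Function.iterate_succ_apply' _ _ _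
      rw [h3]
      omega
  have hcov : ∀ i : Fin (n - 1), Cover (g i).1 (g (i + 1)).1 := fun i => by
    have h3 : g (i + 1) = next (g i) := Function.iterate_succ_apply' _ _ _
    rw [h3]
    exact hnext _ (by rw [hg] <;> omega)
  refine ⟨fun i => (g i).1, h₀, fun i => by simpa using hcov i, ?_⟩
  refine eq_range_of_chain hn h₀ (fun i => by simpa using hcov i) c.chain_le ?_
  rintro _ ⟨i, rfl⟩
  exact (g i).2

theorem exists_flag_eq_range (hn : 1 ≤ n) {f : Fin (n - 1 + 1) → NCCP n}
    (h₀ : (f 0).tree = bot n) (hf : ∀ i : Fin (n - 1), Cover (f i.castSucc) (f i.succ)) :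
    ∃ c : Flag (NCCP n), Set.range f = c :=
  ⟨⟨Set.range f, (Fin.strictMono_iff_lt_succ.2 fun i => (hf i).lt).monotone.isChain_range,
    fun _ hs hfs => eq_range_of_chain hn h₀ hf hs hfs⟩, rfl⟩

end NCCP

namespace LabeledTree

open BinaryTree

/-! ### Sequences of trees -/

theorem path_ofFn {m : ℕ} {L : Fin m → ℕ × ℕ} {F : Fin (m + 1) → BinaryTree ℕ}
    (h : ∀ i : Fin m, Rot (L i).1 (L i).2 (F i.castSucc) (F i.succ)) :
    Path (List.ofFn L) (F 0) (F (Fin.last m)) := by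
  induction m with
  | zero => exact rfl
  | succ m ih =>
    rw [List.ofFn_succ]
    exact ⟨F 1, h 0, ih (L := fun i => L i.succ) (F := fun i => F i.succ) fun i => h i.succ⟩

theorem exists_of_path_ofFn {m : ℕ} {L : Fin m → ℕ × ℕ} {t u : BinaryTree ℕ}
    (h : Path (List.ofFn L) t u) : ∃ F : Fin (m + 1) → BinaryTree ℕ, F 0 = t ∧
      ∀ i : Fin m, Rot (L i).1 (L i).2 (F i.castSucc) (F i.succ) := by
  induction m generalizing t with
  | zero => exact ⟨fun _ => t, rfl, fun i => i.elim0⟩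
  | succ m ih =>
    rw [List.ofFn_succ] at h
    obtain ⟨t', h1, h2⟩ := h
    obtain ⟨F, h3, h4⟩ := ih h2
    refine ⟨Fin.cons t F, rfl, fun i => ?_⟩
    refine Fin.cases ?_ (fun i => ?_) i
    · simpa [h3] using h1
    · simpa [← Fin.succ_castSucc] using h4 i

theorem path_unique {n m : ℕ} (hn : 1 ≤ n) {L₁ : List (ℕ × ℕ)} {L : Fin m → ℕ × ℕ}
    (hL : ValidLabels n (L₁ ++ List.ofFn L)) {F F' : Fin (m + 1) → BinaryTree ℕ}
    (h₀ : Path L₁ (bot n) (F 0)) (h₀' : Path L₁ (bot n) (F' 0))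
    (h : ∀ i : Fin m, Rot (L i).1 (L i).2 (F i.castSucc) (F i.succ))
    (h' : ∀ i : Fin m, Rot (L i).1 (L i).2 (F' i.castSucc) (F' i.succ))
    (i : Fin (m + 1)) : F i = F' i := by
  induction m generalizing L₁ with
  | zero =>
    rw [Fin.fin_one_eq_zero i]
    exact OnPath.unique hn hL ⟨h₀, _, path_ofFn h⟩ ⟨h₀', _, path_ofFn h'⟩
  | succ m ih =>
    refine Fin.cases ?_ (fun i => ?_) i
    · exact OnPath.unique hn hL ⟨h₀, _, path_ofFn h⟩ ⟨h₀', _, path_ofFn h'⟩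
    · refine ih (L₁ := L₁ ++ [L 0]) (L := fun i => L i.succ) (F := fun i => F i.succ)
        (F' := fun i => F' i.succ) ?_ (path_append.2 ⟨_, h₀, _, h 0, rfl⟩)
        (path_append.2 ⟨_, h₀', _, h' 0, rfl⟩) (fun i => h i.succ) (fun i => h' i.succ) i
      rw [List.ofFn_succ] at hL
      simpa using hL

end LabeledTree

/-! ### Labeled parking functions -/

/-- A sequence that is bounded by a permutation is a parking function: fewer than `m - i` of its
entries exceed `i + 1`. -/
theorem isParkingFunction_of_le {m : ℕ} {a b : Fin m → ℕ} (ha : ∀ i, 1 ≤ a i)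
    (hb : ∀ i, b i ≤ m) (hinj : Function.Injective b) (hab : ∀ i, a i ≤ b i) :
    IsParkingFunction a := by
  refine ⟨fun i => Finset.mem_Icc.2 ⟨ha i, (hab i).trans (hb i)⟩, fun i => ?_⟩
  by_contra! hi
  have hmaps : ∀ j ∈ Finset.Ici i, b (Tuple.sort a j) ∈ Finset.Icc ((i : ℕ) + 2) m := by
    intro j hj
    rw [Finset.mem_Icc]
    refine ⟨?_, hb _⟩
    have h1 : (a ∘ Tuple.sort a) i ≤ (a ∘ Tuple.sort a) j :=
      Tuple.monotone_sort a (Finset.mem_Ici.1 hj)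
    exact (hi.trans_le h1).trans_le (hab _)
  have hcard := Finset.card_le_card_of_injOn _ hmaps
    (hinj.comp (Tuple.sort a).injective).injOn
  rw [Fin.card_Ici, Nat.card_Icc] at hcard
  have := i.2
  omega

namespace LabeledParkingFunction

variable {m : ℕ}

theorem b_injective (p : LabeledParkingFunction m) : Function.Injective p.b := fun i _ h =>
  (p.b_perm (p.b i) (p.b_mem i)).unique rfl h.symm

/-- The permutation `b`, as a permutation of `Fin m`. -/
noncomputable def perm (p : LabeledParkingFunction m) : Equiv.Perm (Fin m) :=
  Equiv.ofBijective (fun i => ⟨p.b i - 1, by have := Finset.mem_Icc.1 (p.b_mem i); omega⟩)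
    (Finite.injective_iff_bijective.1 fun i j h => p.b_injective (by
      have h1 := Finset.mem_Icc.1 (p.b_mem i)
      have h2 := Finset.mem_Icc.1 (p.b_mem j)
      simp only [Fin.mk.injEq] at h
      omega))

theorem perm_apply (p : LabeledParkingFunction m) (i : Fin m) : (p.perm i : ℕ) = p.b i - 1 := rfl

/-- The labeled parking function with `b i = σ i + 1` and `a i = f (σ i) + 1`; the shifts by `1`
account for `Fin m` starting at `0`. -/
def ofPerm (σ : Equiv.Perm (Fin m)) (f : (j : Fin m) → Fin ((j : ℕ) + 1)) :
    LabeledParkingFunction m where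
  a i := f (σ i) + 1
  b i := σ i + 1
  isParkingFunction := isParkingFunction_of_le (b := fun i => (σ i : ℕ) + 1)
    (fun i => by omega) (fun i => (σ i).2)
    (fun i j h => σ.injective (Fin.ext (by simpa using h)))
    (fun i => by have := (f (σ i)).2; omega)
  b_mem i := Finset.mem_Icc.2 ⟨by omega, (σ i).2⟩
  b_perm p hp := by
    rw [Finset.mem_Icc] at hp
    refine ⟨σ.symm ⟨p - 1, by omega⟩, ?_, fun i hi => ?_⟩
    · simp only [Equiv.apply_symm_apply]; omega
    · rw [Equiv.eq_symm_apply]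
      exact Fin.ext (by simp only at hi ⊢; omega)
  a_le_b i := by have := (f (σ i)).2; omega

theorem perm_ofPerm (σ : Equiv.Perm (Fin m)) (f : (j : Fin m) → Fin ((j : ℕ) + 1)) :
    (ofPerm σ f).perm = σ :=
  Equiv.ext fun _ => Fin.ext (by simp [perm_apply, ofPerm])

/-- A labeled parking function consists of a permutation `b` and of numbers `1 ≤ a i ≤ b i`. -/
noncomputable def equivPerm (m : ℕ) :
    LabeledParkingFunction m ≃ Equiv.Perm (Fin m) × ((j : Fin m) → Fin ((j : ℕ) + 1)) where
  toFun p := (p.perm, fun j => ⟨p.a (p.perm.symm j) - 1, by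
    have h1 := p.a_le_b (p.perm.symm j)
    have h2 := p.perm_apply (p.perm.symm j)
    rw [Equiv.apply_symm_apply] at h2
    omega⟩)
  invFun q := ofPerm q.1 q.2
  left_inv p := by
    ext i
    · have := Finset.mem_Icc.1 (p.isParkingFunction.1 i)
      simp only [ofPerm, Equiv.symm_apply_apply]
      omega
    · have := Finset.mem_Icc.1 (p.b_mem i)
      simp only [ofPerm, perm_apply]
      omega
  right_inv q := by
    refine Prod.ext (perm_ofPerm _ _) (funext fun j => Fin.ext ?_)
    change (q.2 (q.1 ((ofPerm q.1 q.2).perm.symm j)) : ℕ) + 1 - 1 = q.2 j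
    rw [perm_ofPerm, Equiv.apply_symm_apply, Nat.add_sub_cancel]

theorem card_eq (m : ℕ) : Nat.card (LabeledParkingFunction m) = (m !) ^ 2 := by
  rw [Nat.card_congr (equivPerm m), Nat.card_prod, Nat.card_perm, Nat.card_pi, Nat.card_fin]
  simp only [Nat.card_fin]
  rw [Fin.prod_univ_eq_prod_range (fun i => i + 1), Finset.prod_range_add_one_eq_factorial, sq]

open LabeledTree

theorem validLabels {n : ℕ} (p : LabeledParkingFunction (n - 1)) :
    ValidLabels n (List.ofFn fun i => (p.a i, p.b i + 1)) := by
  constructor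
  · rw [List.map_ofFn, List.perm_ext_iff_of_nodup (List.nodup_ofFn.2 fun i j h =>
      p.b_injective (by simpa using h)) List.nodup_range']
    intro x
    rw [List.mem_ofFn, List.mem_range'_1]
    constructor
    · rintro ⟨i, rfl⟩
      have := Finset.mem_Icc.1 (p.b_mem i)
      simp only [Function.comp]
      omega
    · intro hx
      obtain ⟨i, hi, -⟩ := p.b_perm (x - 1) (Finset.mem_Icc.2 (by omega))
      refine ⟨i, ?_⟩
      simp only [Function.comp]
      omega
  · intro x hx
    rw [List.mem_ofFn] at hx
    obtain ⟨i, rfl⟩ := hx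
    have h1 := Finset.mem_Icc.1 (p.isParkingFunction.1 i)
    have h2 := p.a_le_b i
    exact ⟨h1.1, by simp only; omega⟩

end LabeledParkingFunction

namespace NCCP

open LabeledTree

variable {n : ℕ}

/-! ### Labels of maximal chains -/

/-- The labels of a saturated chain form a labeled parking function. -/
theorem exists_labels {f : Fin (n - 1 + 1) → NCCP n} (h₀ : (f 0).tree = bot n)
    (hf : ∀ i : Fin (n - 1), Cover (f i.castSucc) (f i.succ)) :
    ∃ p : LabeledParkingFunction (n - 1), ∀ (i : Fin (n - 1)) (x y : ℕ),
      CoverLabel (f i.castSucc) (f i.succ) x y ↔ (x = p.a i ∧ y = p.b i + 1) := by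
  choose a b hab using hf
  have hrot := fun i => coverLabel_iff.1 (hab i)
  have ha : ∀ i, 1 ≤ a i := fun i => ((f _).good_tree.mem_iff.1 (hrot i).mem_left).1
  have hb : ∀ i, b i ≤ n := fun i => ((f _).good_tree.mem_iff.1 (hrot i).mem_right).2
  have hlt : ∀ i, a i < b i := fun i => (hrot i).lt (f _).good_tree.1
  have hpath : Path (List.ofFn fun i => (a i, b i)) (f 0).tree (f (Fin.last _)).tree :=
    path_ofFn (F := fun i => (f i).tree) hrot
  have hinj : Function.Injective b := by
    have h1 := hpath.lefts true
    rw [h₀, lefts_bot] at h1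
    have h2 : (List.range' 1 n).Nodup := List.nodup_range'
    rw [← Multiset.coe_nodup, h1, Multiset.nodup_add, Multiset.coe_nodup, List.map_ofFn,
      List.nodup_ofFn] at h2
    exact h2.1
  have hinj' : Function.Injective fun i => b i - 1 := fun i j h => hinj (by
    have := ha i
    have := hlt i
    have := ha j
    have := hlt j
    simp only at h
    omega)
  have hmem : ∀ i, b i - 1 ∈ Finset.Icc 1 (n - 1) := fun i => by
    have := ha i
    have := hlt i
    have := hb i
    rw [Finset.mem_Icc]
    omega
  have himg : Finset.univ.image (fun i => b i - 1) = Finset.Icc 1 (n - 1) := by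
    refine Finset.eq_of_subset_of_card_le ?_ ?_
    · intro x hx
      obtain ⟨i, -, rfl⟩ := Finset.mem_image.1 hx
      exact hmem i
    · rw [Finset.card_image_of_injective _ hinj']
      simp
  have hle : ∀ i, a i ≤ b i - 1 := fun i => Nat.le_sub_one_of_lt (hlt i)
  refine ⟨⟨a, fun i => b i - 1, isParkingFunction_of_le ha
    (fun i => (Finset.mem_Icc.1 (hmem i)).2) hinj' hle, hmem, fun p hp => ?_, hle⟩,
    fun i x y => ?_⟩
  · rw [← himg] at hp
    obtain ⟨i, -, hi⟩ := Finset.mem_image.1 hp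
    exact ⟨i, hi, fun j hj => hinj' (hj.trans hi.symm)⟩
  · have hy : b i - 1 + 1 = b i := by
      have := Finset.mem_Icc.1 (hmem i)
      omega
    simp only [hy]
    constructor
    · exact fun h => (coverLabel_iff.1 h).label_unique (hrot i)
    · rintro ⟨rfl, rfl⟩
      exact hab i

end NCCP

theorem mainTheorem2 (n : ℕ) (hn : 1 ≤ n) :
    Nat.card (Flag (NCCP n)) = ((n - 1)!) ^ 2 ∧
    ∃ e : Flag (NCCP n) ≃ LabeledParkingFunction (n - 1),
      ∀ c : Flag (NCCP n), ∃ π : Fin (n - 1 + 1) → NCCP n,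
        StrictMono π ∧ Set.range π = (c : Set (NCCP n)) ∧
        ∀ (i : Fin (n - 1)) (x y : ℕ),
          NCCP.CoverLabel (π i.castSucc) (π i.succ) x y ↔
            (x = (e c).a i ∧ y = (e c).b i + 1) := by
  have hex : ∀ c : Flag (NCCP n), ∃ (p : LabeledParkingFunction (n - 1))
      (π : Fin (n - 1 + 1) → NCCP n), (π 0).tree = LabeledTree.bot n ∧ StrictMono π ∧
        Set.range π = (c : Set (NCCP n)) ∧ ∀ (i : Fin (n - 1)) (x y : ℕ),
          NCCP.CoverLabel (π i.castSucc) (π i.succ) x y ↔ (x = p.a i ∧ y = p.b i + 1) := by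
    intro c
    obtain ⟨f, h₀, hf, hc⟩ := NCCP.exists_range_eq_flag hn c
    obtain ⟨p, hp⟩ := NCCP.exists_labels h₀ hf
    exact ⟨p, f, h₀, Fin.strictMono_iff_lt_succ.2 fun i => (hf i).lt, hc, hp⟩
  choose Φ chain h₀ hmono hrange hlabel using hex
  have hinj : Function.Injective Φ := by
    intro c c' h
    have hrot := fun i => NCCP.coverLabel_iff.1 ((hlabel c i _ _).2 ⟨rfl, rfl⟩)
    have hrot' := fun i => NCCP.coverLabel_iff.1 ((hlabel c' i _ _).2 ⟨rfl, rfl⟩)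
    rw [← h] at hrot'
    have heq := LabeledTree.path_unique hn (L₁ := []) (L := fun i => ((Φ c).a i, (Φ c).b i + 1))
      (Φ c).validLabels (F := fun i => (chain c i).tree) (F' := fun i => (chain c' i).tree)
      (h₀ c).symm (h₀ c').symm hrot hrot'
    have : chain c = chain c' := funext fun i => NCCP.tree_injective (heq i)
    refine SetLike.coe_injective ?_
    rw [← hrange c, ← hrange c', this]
  have hsurj : Function.Surjective Φ := by
    intro p
    obtain ⟨v, hv⟩ := LabeledTree.exists_path hn p.validLabels
    obtain ⟨F, hF, hrot⟩ := LabeledTree.exists_of_path_ofFn hv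
    have hgood : ∀ i, LabeledTree.Good n (F i) := fun i => by
      induction i using Fin.induction with
      | zero => exact hF ▸ LabeledTree.good_bot n
      | succ i ih => exact ih.rot (hrot i)
    choose f hf using fun i => NCCP.exists_tree_eq (hgood i)
    have hcov : ∀ i, NCCP.CoverLabel (f (Fin.castSucc i)) (f i.succ) (p.a i) (p.b i + 1) := fun i => by
      rw [NCCP.coverLabel_iff, hf, hf]
      exact hrot i
    obtain ⟨c, hc⟩ := NCCP.exists_flag_eq_range hn (f := f) ((hf 0).trans hF) fun i => ⟨_, _, hcov i⟩
    have heq : chain c = f := (hmono c).range_inj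
      (Fin.strictMono_iff_lt_succ.2 fun i => NCCP.Cover.lt ⟨_, _, hcov i⟩) |>.1 ((hrange c).trans hc.symm)
    refine ⟨c, ?_⟩
    have hl := fun i => (hlabel c i _ _).1 (heq.symm ▸ hcov i)
    ext i
    · exact (hl i).1.symm
    · have := (hl i).2
      omega
  let e := Equiv.ofBijective Φ ⟨hinj, hsurj⟩
  refine ⟨?_, e, fun c => ⟨chain c, hmono c, hrange c, hlabel c⟩⟩
  rw [Nat.card_congr e, LabeledParkingFunction.card_eq]
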